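/- All graphs are finite and simple. For a graph $G$ on $n$ vertices let $\phi(m,G)$ be the number of $m$-matchings of $G$ (sets of $m$ edges, no two sharing a vertex), with $\phi(0,G)=1$, and let $\Phi_G(x)=\sum_{m=0}^{\lfloor n/2\rfloor}\phi(m,G)x^m$. For $f,g\in\mathbb{R}[x]$ write $f\preceq g$ if all coefficients of $g-f$ are nonnegative, and $f\prec g$ if $f\preceq g$ and $f\ne g$. $P_i$ and $C_i$ denote the path and the cycle on $i$ vertices, $qG$ is the disjoint union of $q$ copies of $G$, $\cup$ is disjoint union, and graphs are identified when they are isomorphic. Let $\Omega_{\mathrm{bi}}(n,k)$ be the set of bipartite graphs on $n$ vertices with exactly $2k$ vertices of degree $1$ and all the other $n-2k$ vertices of degree $2$. **Theorem.** Let $2\le 2k\le n$, put $l=n-2k$ and assume $l\ge 2$. Let $F$ be a graph given by the list 1. if $l-k\le 0$: $F=lP_3\cup(k-l)P_2$; 2. if $l-k>0$: (a) if $l-k\in\{1,2\}$: $F=(k-1)P_3\cup P_{l-k+3}$; (b) if $l-k\ge 4$ is even: $F=kP_3\cup C_{l-k}$, or, when $l-k=4$, also $F=(k-1)P_3\cup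 P_7$ (either choice is allowed); (c) if $l-k\ge 3$ is odd: $F=(k-1)P_3\cup P_{l-k+3}$; and let $H$ be a graph given by the list 3. if $l=2$: $H=(k-1)P_2\cup P_4$; 4. if $l=3$: $H=(k-1)P_2\cup P_5$; 5. if $l\ge 4$, $l\equiv 0 \pmod 4$: $H=kP_2\cup\frac{l}{4}C_4$; 6. if $l\ge 5$, $l\equiv 1\pmod 4$: $H=(k-1)P_2\cup\frac{l-1}{4}C_4\cup P_3$ or $H=(k-1)P_2\cup\frac{l-5}{4}C_4\cup P_7$ (either choice is allowed); 7. if $l\ge 6$, $l\equiv 2\pmod 4$: $H=kP_2\cup\frac{l-6}{4}C_4\cup C_6$; 8. if $l\ge 7$, $l\equiv 3\pmod 4$: $H=(k-1)P_2\cup\frac{l-3}{4}C_4\cup P_5$. Such $F$ and $H$ exist, and all of them belong to $\Omega_{\mathrm{bi}}(n,k)$. For every $G\in\Omega_{\mathrm{bi}}(n,k)$ and all such $F$ and $H$, $$\Phi_F\preceq\Phi_G\preceq\Phi_H .$$ Furthermore, if $G$ is none of the graphs $F$ listed for $(n,k)$ then $\Phi_F\prec\Phi_G$, and if $G$ is none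 of the graphs $H$ listed for $(n,k)$ then $\Phi_G\prec\Phi_H$. -/

import Mathlib

open Polynomial SimpleGraph

/-- An `m`-matching of `G`: a set of `m` edges of `G`, no two of which share a vertex. -/
def IsMMatching {V : Type*} (G : SimpleGraph V) (m : ℕ) (M : Finset (Sym2 V)) : Prop :=
  (∀ e ∈ M, e ∈ G.edgeSet) ∧ M.card = m ∧
    ∀ e ∈ M, ∀ f ∈ M, e ≠ f → ∀ v : V, ¬ (v ∈ e ∧ v ∈ f)

/-- `φ(m, G)`, the number of `m`-matchings of `G`. -/
noncomputable def matchingCount {V : Type*} (m : ℕ) (G : SimpleGraph V) : ℕ :=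
  {M : Finset (Sym2 V) | IsMMatching G m M}.ncard

/-- The generating matching polynomial `Φ_G(x) = ∑_{m=0}^{⌊n/2⌋} φ(m, G) x^m` of a graph on `n`
vertices. -/
noncomputable def matchingPoly {n : ℕ} (G : SimpleGraph (Fin n)) : ℝ[X] :=
  ∑ m ∈ Finset.range (n / 2 + 1), C (matchingCount m G : ℝ) * X ^ m

/-- `f ⪯ g`: all coefficients of `g - f` are nonnegative. -/
def CoeffLE (f g : ℝ[X]) : Prop := ∀ i : ℕ, 0 ≤ (g - f).coeff i

/-- `f ≺ g`: `f ⪯ g` and `f ≠ g`. -/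
def CoeffLT (f g : ℝ[X]) : Prop := CoeffLE f g ∧ g ≠ f

/-- `q G`: the disjoint union of `q` copies of `G`. -/
def copies {V : Type*} (q : ℕ) (G : SimpleGraph V) : SimpleGraph (Fin q × V) where
  Adj a b := a.1 = b.1 ∧ G.Adj a.2 b.2
  symm := ⟨fun _ _ h => ⟨h.1.symm, h.2.symm⟩⟩
  loopless := ⟨fun _ h => G.loopless.irrefl _ h.2⟩

/-- Equality of (unlabelled) graphs, i.e. isomorphism. -/
def IsoTo {V W : Type*} (G : SimpleGraph V) (H : SimpleGraph W) : Prop := Nonempty (G ≃g H)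

open Classical in
/-- `Ω_bi(n, k)`: the simple bipartite graphs on `n` vertices with exactly `2k` vertices of
degree `1`, all the other vertices having degree `2`. -/
def OmegaBi (n k : ℕ) : Set (SimpleGraph (Fin n)) :=
  {G | G.IsBipartite ∧ (Finset.univ.filter fun v => G.degree v = 1).card = 2 * k ∧
    ∀ v, G.degree v = 1 ∨ G.degree v = 2}

/-- The graphs `F` on `n` vertices (up to isomorphism), where `n = 2k + l`. -/
def GraphsF (n k l : ℕ) : Set (SimpleGraph (Fin n)) :=
  {F | (l ≤ k ∧ IsoTo F (copies l (pathGraph 3) ⊕g copies (k - l) (pathGraph 2))) ∨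
    ((l = k + 1 ∨ l = k + 2) ∧
      IsoTo F (copies (k - 1) (pathGraph 3) ⊕g pathGraph (l - k + 3))) ∨
    (k + 4 ≤ l ∧ Even (l - k) ∧
      IsoTo F (copies k (pathGraph 3) ⊕g cycleGraph (l - k))) ∨
    (l = k + 4 ∧ IsoTo F (copies (k - 1) (pathGraph 3) ⊕g pathGraph 7)) ∨
    (k + 3 ≤ l ∧ Odd (l - k) ∧
      IsoTo F (copies (k - 1) (pathGraph 3) ⊕g pathGraph (l - k + 3)))}

/-- The graphs `H` on `n` vertices (up to isomorphism), where `n = 2k + l`. -/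
def GraphsH (n k l : ℕ) : Set (SimpleGraph (Fin n)) :=
  {H | (l = 2 ∧ IsoTo H (copies (k - 1) (pathGraph 2) ⊕g pathGraph 4)) ∨
    (l = 3 ∧ IsoTo H (copies (k - 1) (pathGraph 2) ⊕g pathGraph 5)) ∨
    (4 ≤ l ∧ l % 4 = 0 ∧
      IsoTo H (copies k (pathGraph 2) ⊕g copies (l / 4) (cycleGraph 4))) ∨
    (5 ≤ l ∧ l % 4 = 1 ∧
      IsoTo H ((copies (k - 1) (pathGraph 2) ⊕g copies ((l - 1) / 4) (cycleGraph 4)) ⊕g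
        pathGraph 3)) ∨
    (5 ≤ l ∧ l % 4 = 1 ∧
      IsoTo H ((copies (k - 1) (pathGraph 2) ⊕g copies ((l - 5) / 4) (cycleGraph 4)) ⊕g
        pathGraph 7)) ∨
    (6 ≤ l ∧ l % 4 = 2 ∧
      IsoTo H ((copies k (pathGraph 2) ⊕g copies ((l - 6) / 4) (cycleGraph 4)) ⊕g
        cycleGraph 6)) ∨
    (7 ≤ l ∧ l % 4 = 3 ∧
      IsoTo H ((copies (k - 1) (pathGraph 2) ⊕g copies ((l - 3) / 4) (cycleGraph 4)) ⊕g
        pathGraph 5))}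

/-! A graph whose degrees are all 1 or 2 is a disjoint union of paths on at least two vertices and
of cycles. Each path has two leaves and a cycle has none, so membership in
$\Omega_{\mathrm{bi}}(n,k)$ means exactly $k$ paths, even cycles only, and $n$ vertices in all. The
matching polynomial is multiplicative over disjoint unions, so only products of path and cycle
polynomials have to be compared.

Deleting an edge shows that both families satisfy $a_{n+2}=a_{n+1}+x\,a_n$; they are of Fibonacci
and Lucas type. The product identities of such sequences (`pathSeq_two_mul`, `pathSeq_mul_eq_three`,
`pathSeq_mul_cycleSeq_eq_three`, `cycleSeq_mul`, `pathSeq_mul_cycleSeq`, `pathSeq_mul_cycleSeq'`)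
compare one or two components with others on equally many vertices. The difference is a monomial
times path or cycle polynomials, with a sign fixed by parity. Hence exchanging a few components
changes the product strictly and in a known direction.

A case analysis (`GoodShape.isShapeF_or_exists_lt`, `GoodShape.isShapeH_or_exists_gt`) finds a
strictly improving exchange for every shape that is not listed. There are finitely many graphs on
$n$ vertices and the strict order is transitive, so repeated improvement ends at a listed graph. The
listed graphs for given $(n,k)$ have one common polynomial, because $P_3\cup C_4$ and $P_7$ have the
same one. This proves the bounds together with their strictness. -/

/-! ### The coefficientwise order on polynomials. -/

/-- All coefficients of `f` are nonnegative and `f` is nonzero. -/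
def CoeffPos (f : ℝ[X]) : Prop := (∀ i, 0 ≤ f.coeff i) ∧ f ≠ 0

namespace CoeffPos

lemma add {f g : ℝ[X]} (hf : CoeffPos f) (hg : CoeffPos g) : CoeffPos (f + g) := by
  refine ⟨fun i => by rw [coeff_add]; exact add_nonneg (hf.1 i) (hg.1 i), fun h => hf.2 ?_⟩
  ext i
  have := congrArg (fun p => coeff p i) h
  simp only [coeff_add, coeff_zero] at this ⊢
  linarith [hf.1 i, hg.1 i]

lemma mul {f g : ℝ[X]} (hf : CoeffPos f) (hg : CoeffPos g) : CoeffPos (f * g) := by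
  refine ⟨fun i => ?_, mul_ne_zero hf.2 hg.2⟩
  rw [coeff_mul]
  exact Finset.sum_nonneg fun x _ => mul_nonneg (hf.1 _) (hg.1 _)

lemma one : CoeffPos 1 := by
  refine ⟨fun i => ?_, one_ne_zero⟩
  rw [coeff_one]; split_ifs <;> norm_num

lemma X : CoeffPos (X : ℝ[X]) := by
  refine ⟨fun i => ?_, X_ne_zero⟩
  rw [coeff_X]; split_ifs <;> norm_num

lemma two : CoeffPos 2 := by
  have := one.add one
  rwa [one_add_one_eq_two] at this

lemma pow {f : ℝ[X]} (hf : CoeffPos f) (n : ℕ) : CoeffPos (f ^ n) := by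
  induction n with
  | zero => simpa using one
  | succ n ih => rw [pow_succ]; exact ih.mul hf

lemma multiset_prod_map (f : ℕ → ℝ[X]) (hf : ∀ n, CoeffPos (f n)) (s : Multiset ℕ) :
    CoeffPos (s.map f).prod := by
  induction s using Multiset.induction with
  | empty => simpa using one
  | cons a s ih => simpa using (hf a).mul ih

end CoeffPos

lemma coeffLT_iff {f g : ℝ[X]} : CoeffLT f g ↔ CoeffPos (g - f) := by
  simp [CoeffLT, CoeffLE, CoeffPos, sub_eq_zero]

/-- Every comparison below has this form: an exact identity whose remainder `h` is visibly positive.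
-/
lemma coeffLT_of_eq_add {f g h : ℝ[X]} (hh : CoeffPos h) (e : g = f + h) : CoeffLT f g := by
  rw [coeffLT_iff, e, add_sub_cancel_left]; exact hh

lemma CoeffLT.mul_right {f g h : ℝ[X]} (hfg : CoeffLT f g) (hh : CoeffPos h) :
    CoeffLT (f * h) (g * h) := by
  rw [coeffLT_iff] at *
  rw [← sub_mul]; exact hfg.mul hh

lemma CoeffLT.trans {f g h : ℝ[X]} (hfg : CoeffLT f g) (hgh : CoeffLT g h) : CoeffLT f h := by
  rw [coeffLT_iff] at *
  simpa using hgh.add hfg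

lemma CoeffLT.irrefl (f : ℝ[X]) : ¬ CoeffLT f f := fun h => h.2 rfl

lemma CoeffLE.refl (f : ℝ[X]) : CoeffLE f f := fun i => by simp

/-! ### Path and cycle polynomials and their product identities. -/

/-- The matching generating polynomials of paths. -/
noncomputable def pathSeq : ℕ → ℝ[X]
  | 0 => 1
  | 1 => 1
  | n + 2 => pathSeq (n + 1) + X * pathSeq n

/-- The matching generating polynomials of cycles, extended to sizes below `3` by the recursion. -/
noncomputable def cycleSeq : ℕ → ℝ[X]
  | 0 => 2
  | 1 => 1
  | n + 2 => cycleSeq (n + 1) + X * cycleSeq n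

lemma pathSeq_zero : pathSeq 0 = 1 := by rw [pathSeq]
lemma pathSeq_one : pathSeq 1 = 1 := by rw [pathSeq]
lemma pathSeq_add_two (n : ℕ) : pathSeq (n + 2) = pathSeq (n + 1) + X * pathSeq n := by
  rw [pathSeq]
lemma cycleSeq_zero : cycleSeq 0 = 2 := by rw [cycleSeq]
lemma cycleSeq_one : cycleSeq 1 = 1 := by rw [cycleSeq]
lemma cycleSeq_add_two (n : ℕ) : cycleSeq (n + 2) = cycleSeq (n + 1) + X * cycleSeq n := by
  rw [cycleSeq]

/-- Solutions of the recursion are determined by two values, so an identity linear in one index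
needs checking at 0 and 1 only. -/
lemma seq_ext {a b : ℕ → ℝ[X]} (h0 : a 0 = b 0) (h1 : a 1 = b 1)
    (ha : ∀ n, a (n + 2) = a (n + 1) + X * a n) (hb : ∀ n, b (n + 2) = b (n + 1) + X * b n)
    (n : ℕ) : a n = b n := by
  induction n using Nat.twoStepInduction with
  | zero => exact h0
  | one => exact h1
  | more n h h' => rw [ha, hb, h, h']

lemma pathSeq_pos (n : ℕ) : CoeffPos (pathSeq n) := by
  induction n using Nat.twoStepInduction with
  | zero => rw [pathSeq_zero]; exact .one
  | one => rw [pathSeq_one]; exact .one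
  | more n h h' => rw [pathSeq_add_two]; exact h'.add (CoeffPos.X.mul h)

lemma cycleSeq_pos (n : ℕ) : CoeffPos (cycleSeq n) := by
  induction n using Nat.twoStepInduction with
  | zero => rw [cycleSeq_zero]; exact .two
  | one => rw [cycleSeq_one]; exact .one
  | more n h h' => rw [cycleSeq_add_two]; exact h'.add (CoeffPos.X.mul h)

lemma cycleSeq_eq_pathSeq (n : ℕ) : cycleSeq (n + 2) = pathSeq (n + 2) + X * pathSeq n := by
  refine seq_ext (a := fun n => cycleSeq (n + 2))
    (b := fun n => pathSeq (n + 2) + X * pathSeq n) ?_ ?_ (fun n => ?_) (fun n => ?_) n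
  · simp only [cycleSeq, pathSeq]; ring
  · simp only [cycleSeq, pathSeq]; ring
  · simp only [cycleSeq_add_two]
  · simp only [pathSeq_add_two]; ring

lemma pathSeq_add (a b : ℕ) :
    pathSeq (a + b + 2) = pathSeq (a + 1) * pathSeq (b + 1) + X * (pathSeq a * pathSeq b) := by
  refine seq_ext (a := fun b => pathSeq (a + b + 2))
    (b := fun b => pathSeq (a + 1) * pathSeq (b + 1) + X * (pathSeq a * pathSeq b))
    ?_ ?_ (fun n => ?_) (fun n => ?_) b
  · simp only [pathSeq]; ring
  · simp only [pathSeq]; ring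
  · exact pathSeq_add_two (a + n + 2)
  · simp only [pathSeq_add_two]; ring

lemma cycleSeq_add (a b : ℕ) :
    cycleSeq (a + b + 2) = pathSeq (a + 1) * cycleSeq (b + 1) + X * (pathSeq a * cycleSeq b) := by
  refine seq_ext (a := fun a => cycleSeq (a + b + 2))
    (b := fun a => pathSeq (a + 1) * cycleSeq (b + 1) + X * (pathSeq a * cycleSeq b))
    ?_ ?_ (fun n => ?_) (fun n => ?_) a
  · simp only [pathSeq, cycleSeq, zero_add]; ring
  · simp only [pathSeq, show 1 + b + 2 = b + 1 + 2 by ring, cycleSeq_add_two]; ring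
  · simp only [show n + 2 + b + 2 = n + b + 2 + 2 by ring, cycleSeq_add_two,
      show n + 1 + b + 2 = n + b + 1 + 2 by ring]
  · simp only [pathSeq_add_two]; ring

lemma pathSeq_two_mul (a b : ℕ) : pathSeq 2 * pathSeq (a + b + 4) =
    pathSeq (a + 3) * pathSeq (b + 3) + X ^ 3 * (pathSeq a * pathSeq b) := by
  rw [show a + b + 4 = (a + 1) + (b + 1) + 2 by ring, pathSeq_add (a + 1) (b + 1)]
  simp only [pathSeq]; ring

lemma pathSeq_mul_eq_three (a b : ℕ) : pathSeq (a + 4) * pathSeq (b + 4) =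
    pathSeq 3 * pathSeq (a + b + 5) + X ^ 4 * (pathSeq a * pathSeq b) := by
  rw [show a + b + 5 = (a + 1) + (b + 2) + 2 by ring, pathSeq_add (a + 1) (b + 2)]
  simp only [pathSeq]; ring

lemma pathSeq_mul_cycleSeq_eq_three (a b : ℕ) : pathSeq (a + 4) * cycleSeq (b + 4) =
    pathSeq 3 * cycleSeq (a + b + 5) + X ^ 4 * (pathSeq a * cycleSeq b) := by
  rw [show a + b + 5 = (a + 1) + (b + 2) + 2 by ring, cycleSeq_add (a + 1) (b + 2)]
  simp only [pathSeq, cycleSeq_add_two]; ring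

/-- The analogue of $L_{s+n}L_n=L_{s+2n}\pm L_s$. For $s=0$ it relies on the convention `cycleSeq 0
= 2`. In the induction $s$ is shifted by 1 and 2, so that the index $s+n$ of the first factor stays
fixed while the recursion acts on the second. -/
lemma cycleSeq_mul (s n : ℕ) :
    cycleSeq (s + n) * cycleSeq n = cycleSeq (s + 2 * n) + (-X) ^ n * cycleSeq s := by
  induction n using Nat.twoStepInduction generalizing s with
  | zero => simp only [cycleSeq]; ring_nf
  | one => simp only [cycleSeq]; ring_nf
  | more n h h' =>
    have e1 := h (s + 2)
    have e2 := h' (s + 1)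
    rw [show s + (n + 2) = s + 2 + n by ring, cycleSeq_add_two n, mul_add,
      show s + 2 + n = s + 1 + (n + 1) by ring, e2,
      show s + 1 + (n + 1) = s + 2 + n by ring, mul_left_comm, e1,
      show s + 2 * (n + 2) = s + 2 * n + 2 + 2 by ring, cycleSeq_add_two (s + 2 * n + 2),
      cycleSeq_add_two s]
    ring_nf

lemma pathSeq_mul_cycleSeq (s n : ℕ) :
    pathSeq (s + n) * cycleSeq n = pathSeq (s + 2 * n) + (-X) ^ n * pathSeq s := by
  induction n using Nat.twoStepInduction generalizing s with
  | zero => simp only [cycleSeq]; ring_nf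
  | one => simp only [cycleSeq, pathSeq]; ring_nf
  | more n h h' =>
    have e1 := h (s + 2)
    have e2 := h' (s + 1)
    rw [show s + (n + 2) = s + 2 + n by ring, cycleSeq_add_two n, mul_add,
      show s + 2 + n = s + 1 + (n + 1) by ring, e2,
      show s + 1 + (n + 1) = s + 2 + n by ring, mul_left_comm, e1,
      show s + 2 * (n + 2) = s + 2 * n + 2 + 2 by ring, pathSeq_add_two (s + 2 * n + 2),
      pathSeq_add_two s]
    ring_nf

/-- Counterpart of `pathSeq_mul_cycleSeq` for a cycle longer than the path by at least two, where
the remainder there would have a negative index. -/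
lemma pathSeq_mul_cycleSeq' (m s : ℕ) :
    pathSeq m * cycleSeq (m + 2 + s) + (-X) ^ (m + 1) * pathSeq s = pathSeq (2 * m + 2 + s) := by
  induction m using Nat.twoStepInduction generalizing s with
  | zero =>
    rw [show 2 * 0 + 2 + s = s + 2 by ring, cycleSeq_eq_pathSeq,
      pathSeq_zero]
    ring
  | one =>
    rw [show 1 + 2 + s = s + 1 + 2 by ring, cycleSeq_eq_pathSeq,
      show 2 * 1 + 2 + s = s + 2 + 2 by ring]
    simp only [pathSeq]
    ring
  | more m h h' =>
    have e1 := h (s + 2)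
    have e2 := h' (s + 1)
    rw [show m + 2 + (s + 2) = m + 2 + 2 + s by ring] at e1
    rw [show m + 1 + 2 + (s + 1) = m + 2 + 2 + s by ring,
      show 2 * (m + 1) + 2 + (s + 1) = 2 * m + 2 + s + 3 by ring] at e2
    rw [show 2 * (m + 2) + 2 + s = 2 * m + 2 + s + 2 + 2 by ring,
      pathSeq_add_two (2 * m + 2 + s + 2), ← e2,
      show 2 * m + 2 + s + 2 = 2 * m + 2 + (s + 2) by ring, ← e1,
      pathSeq_add_two s, pathSeq_add_two m]
    ring

/-! ### Shapes and the exchange of components. -/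

/-- The matching generating polynomial of a disjoint union of paths and cycles with sizes given by
`P` and `C`. -/
noncomputable def shapePoly (P C : Multiset ℕ) : ℝ[X] :=
  (P.map pathSeq).prod * (C.map cycleSeq).prod

/-- Sizes of `k` paths with at least two vertices and of some even cycles on `n` vertices overall. -/
structure GoodShape (n k : ℕ) (P C : Multiset ℕ) : Prop where
  two_le : ∀ a ∈ P, 2 ≤ a
  cycle : ∀ c ∈ C, 4 ≤ c ∧ c % 2 = 0
  card : P.card = k
  sum : P.sum + C.sum = n

lemma shapePoly_add (A B P C : Multiset ℕ) :
    shapePoly (A + P) (B + C) = shapePoly A B * shapePoly P C := by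
  simp only [shapePoly, Multiset.map_add, Multiset.prod_add]; ring

lemma shapePoly_pos (P C : Multiset ℕ) : CoeffPos (shapePoly P C) :=
  (CoeffPos.multiset_prod_map _ pathSeq_pos _).mul (CoeffPos.multiset_prod_map _ cycleSeq_pos _)

lemma GoodShape.replace {n k : ℕ} {P C A B P₀ C₀ : Multiset ℕ} (h : GoodShape n k P C)
    (hP : P = A + P₀) (hC : C = B + C₀) (A' B' : Multiset ℕ) (hA' : ∀ a ∈ A', 2 ≤ a)
    (hB' : ∀ c ∈ B', 4 ≤ c ∧ c % 2 = 0) (hcard : A'.card = A.card)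
    (hsum : A'.sum + B'.sum = A.sum + B.sum) : GoodShape n k (A' + P₀) (B' + C₀) := by
  subst hP hC
  obtain ⟨h1, h2, h3, h4⟩ := h
  simp only [Multiset.mem_add, Multiset.card_add, Multiset.sum_add] at *
  refine ⟨?_, ?_, by simp only [Multiset.card_add]; omega,
    by simp only [Multiset.sum_add]; omega⟩
  · intro a ha
    rcases Multiset.mem_add.1 ha with ha | ha
    exacts [hA' a ha, h1 a (.inr ha)]
  · intro a ha
    rcases Multiset.mem_add.1 ha with ha | ha
    exacts [hB' a ha, h2 a (.inr ha)]

/-- The untouched components `P₀`, `C₀` contribute a common positive factor, so it suffices to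
compare the exchanged ones. -/
lemma GoodShape.exists_lt {n k : ℕ} {P C A B P₀ C₀ : Multiset ℕ} (h : GoodShape n k P C)
    (hP : P = A + P₀) (hC : C = B + C₀) (A' B' : Multiset ℕ) (hA' : ∀ a ∈ A', 2 ≤ a)
    (hB' : ∀ c ∈ B', 4 ≤ c ∧ c % 2 = 0) (hcard : A'.card = A.card)
    (hsum : A'.sum + B'.sum = A.sum + B.sum)
    (hlt : CoeffLT (shapePoly A' B') (shapePoly A B)) :
    ∃ P' C', GoodShape n k P' C' ∧ CoeffLT (shapePoly P' C') (shapePoly P C) := by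
  refine ⟨_, _, h.replace hP hC A' B' hA' hB' hcard hsum, ?_⟩
  rw [hP, hC, shapePoly_add, shapePoly_add]
  exact hlt.mul_right (shapePoly_pos _ _)

lemma GoodShape.exists_gt {n k : ℕ} {P C A B P₀ C₀ : Multiset ℕ} (h : GoodShape n k P C)
    (hP : P = A + P₀) (hC : C = B + C₀) (A' B' : Multiset ℕ) (hA' : ∀ a ∈ A', 2 ≤ a)
    (hB' : ∀ c ∈ B', 4 ≤ c ∧ c % 2 = 0) (hcard : A'.card = A.card)
    (hsum : A'.sum + B'.sum = A.sum + B.sum)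
    (hlt : CoeffLT (shapePoly A B) (shapePoly A' B')) :
    ∃ P' C', GoodShape n k P' C' ∧ CoeffLT (shapePoly P C) (shapePoly P' C') := by
  refine ⟨_, _, h.replace hP hC A' B' hA' hB' hcard hsum, ?_⟩
  rw [hP, hC, shapePoly_add, shapePoly_add]
  exact hlt.mul_right (shapePoly_pos _ _)

lemma Multiset.exists_eq_replicate_add_replicate {α : Type*} {a b : α} {s : Multiset α}
    (h : ∀ x ∈ s, x = a ∨ x = b) :
    ∃ i j, s = Multiset.replicate i a + Multiset.replicate j b := by
  induction s using Multiset.induction with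
  | empty => exact ⟨0, 0, by simp⟩
  | cons x s ih =>
    obtain ⟨i, j, rfl⟩ := ih fun y hy => h y (Multiset.mem_cons_of_mem hy)
    rcases h x (Multiset.mem_cons_self _ _) with rfl | rfl
    · exact ⟨i + 1, j, by rw [Multiset.replicate_succ, Multiset.cons_add]⟩
    · exact ⟨i, j + 1, by rw [Multiset.replicate_succ, Multiset.add_cons]⟩

/-! ### The extremal shapes and the improving exchanges. -/

/-- The sizes of the paths and cycles of the graphs with the smallest matching polynomial. -/
def IsShapeF (k l : ℕ) (P C : Multiset ℕ) : Prop :=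
  (l ≤ k ∧ P = Multiset.replicate l 3 + Multiset.replicate (k - l) 2 ∧ C = 0) ∨
  ((l = k + 1 ∨ l = k + 2) ∧ P = Multiset.replicate (k - 1) 3 + {l - k + 3} ∧ C = 0) ∨
  (k + 4 ≤ l ∧ (l - k) % 2 = 0 ∧ P = Multiset.replicate k 3 ∧ C = {l - k}) ∨
  (l = k + 4 ∧ P = Multiset.replicate (k - 1) 3 + {7} ∧ C = 0) ∨
  (k + 3 ≤ l ∧ (l - k) % 2 = 1 ∧ P = Multiset.replicate (k - 1) 3 + {l - k + 3} ∧ C = 0)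

/-- The sizes of the paths and cycles of the graphs with the largest matching polynomial. -/
def IsShapeH (k l : ℕ) (P C : Multiset ℕ) : Prop :=
  (l = 2 ∧ P = Multiset.replicate (k - 1) 2 + {4} ∧ C = 0) ∨
  (l = 3 ∧ P = Multiset.replicate (k - 1) 2 + {5} ∧ C = 0) ∨
  (4 ≤ l ∧ l % 4 = 0 ∧ P = Multiset.replicate k 2 ∧ C = Multiset.replicate (l / 4) 4) ∨
  (5 ≤ l ∧ l % 4 = 1 ∧ P = Multiset.replicate (k - 1) 2 + {3} ∧
    C = Multiset.replicate ((l - 1) / 4) 4) ∨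
  (5 ≤ l ∧ l % 4 = 1 ∧ P = Multiset.replicate (k - 1) 2 + {7} ∧
    C = Multiset.replicate ((l - 5) / 4) 4) ∨
  (6 ≤ l ∧ l % 4 = 2 ∧ P = Multiset.replicate k 2 ∧
    C = Multiset.replicate ((l - 6) / 4) 4 + {6}) ∨
  (7 ≤ l ∧ l % 4 = 3 ∧ P = Multiset.replicate (k - 1) 2 + {5} ∧
    C = Multiset.replicate ((l - 3) / 4) 4)

/-- The coincidence behind every tie between listed graphs. -/
lemma pathSeq_three_mul_cycleSeq_four : pathSeq 3 * cycleSeq 4 = pathSeq 7 := by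
  simp only [pathSeq, cycleSeq]; ring

lemma IsShapeF.shapePoly_eq {k l : ℕ} (hk : 1 ≤ k) {P C P' C' : Multiset ℕ}
    (h : IsShapeF k l P C) (h' : IsShapeF k l P' C') : shapePoly P C = shapePoly P' C' := by
  obtain ⟨k, rfl⟩ : ∃ j, k = j + 1 := ⟨k - 1, by omega⟩
  rcases h with ⟨_, rfl, rfl⟩ | ⟨_, rfl, rfl⟩ | ⟨_, _, rfl, rfl⟩ | ⟨_, rfl, rfl⟩ | ⟨_, _, rfl, rfl⟩ <;>
  rcases h' with
    ⟨_, rfl, rfl⟩ | ⟨_, rfl, rfl⟩ | ⟨_, _, rfl, rfl⟩ | ⟨_, rfl, rfl⟩ | ⟨_, _, rfl, rfl⟩ <;>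
  first
  | rfl
  | (exfalso; omega)
  -- Different listed shapes meet only when the cycle is $C_4$ and may be merged with a $P_3$ into
  -- $P_7$; `k` has been lowered by one here.
  | (have e : l = k + 5 := by omega
     subst e
     simp [shapePoly, show k + 5 - (k + 1) = 4 by omega, ← pathSeq_three_mul_cycleSeq_four]
     ring)

lemma IsShapeH.shapePoly_eq {k l : ℕ} {P C P' C' : Multiset ℕ}
    (h : IsShapeH k l P C) (h' : IsShapeH k l P' C') : shapePoly P C = shapePoly P' C' := by
  rcases h with ⟨_, rfl, rfl⟩ | ⟨_, rfl, rfl⟩ | ⟨_, _, rfl, rfl⟩ | ⟨_, _, rfl, rfl⟩ |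
    ⟨_, _, rfl, rfl⟩ | ⟨_, _, rfl, rfl⟩ | ⟨_, _, rfl, rfl⟩ <;>
  rcases h' with ⟨_, rfl, rfl⟩ | ⟨_, rfl, rfl⟩ | ⟨_, _, rfl, rfl⟩ | ⟨_, _, rfl, rfl⟩ |
    ⟨_, _, rfl, rfl⟩ | ⟨_, _, rfl, rfl⟩ | ⟨_, _, rfl, rfl⟩ <;>
  first
  | rfl
  | (exfalso; omega)
  | (simp [shapePoly, show (l - 1) / 4 = (l - 5) / 4 + 1 by omega,
      ← pathSeq_three_mul_cycleSeq_four]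
     ring)

/-- With $d\le c$ the remainder in `cycleSeq_mul` is $(-x)^d$ times `cycleSeq (c - d)`, positive
because $d$ is even. -/
lemma cycleSeq_add_coeffLT {c d : ℕ} (hc : c % 2 = 0) (hd : d % 2 = 0) :
    CoeffLT (cycleSeq (c + d)) (cycleSeq c * cycleSeq d) := by
  wlog hle : d ≤ c generalizing c d
  · rw [add_comm c d, mul_comm]
    exact this hd hc (by omega)
  · obtain ⟨t, rfl⟩ := Nat.exists_eq_add_of_le hle
    refine coeffLT_of_eq_add ((CoeffPos.X.pow d).mul (cycleSeq_pos t)) ?_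
    have := cycleSeq_mul t d
    rw [Even.neg_pow (Nat.even_iff.2 hd), show t + 2 * d = d + t + d by ring, add_comm t] at this
    exact this

lemma GoodShape.isShapeF_or_exists_lt {n k l : ℕ} {P C : Multiset ℕ} (h : GoodShape n k P C)
    (hn : n = 2 * k + l) : IsShapeF k l P C ∨
      ∃ P' C', GoodShape n k P' C' ∧ CoeffLT (shapePoly P' C') (shapePoly P C) := by
  have hsum := h.sum
  have hcard := h.card
  rcases Multiset.empty_or_exists_mem C with rfl | ⟨c, hc⟩
  · by_cases hm : ∃ m ∈ P, 4 ≤ m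
    · obtain ⟨m, hm, hm4⟩ := hm
      obtain ⟨P', rfl⟩ := Multiset.exists_cons_of_mem hm
      obtain ⟨s, rfl⟩ : ∃ s, m = s + 4 := ⟨m - 4, by omega⟩
      -- A path on at least 4 vertices next to a second path other than $P_3$: their vertices are
      -- redistributed so that one of the two becomes $P_3$.
      by_cases hb : ∃ b ∈ P', b ≠ 3
      · right
        obtain ⟨b, hb, hb3⟩ := hb
        obtain ⟨P', rfl⟩ := Multiset.exists_cons_of_mem hb
        have hb2 := h.two_le b (by simp)
        rcases (by omega : b = 2 ∨ 4 ≤ b) with rfl | hb4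
        · refine h.exists_lt (A := {s + 4, 2}) (B := 0) (P₀ := P') (C₀ := 0) (by simp) (by simp)
            {3, s + 3} 0 (by simp) (by simp) (by simp) (by simp; omega) ?_
          refine coeffLT_of_eq_add ((CoeffPos.X.pow 3).mul (pathSeq_pos s)) ?_
          have := pathSeq_two_mul 0 s
          simp only [zero_add, pathSeq_zero] at this
          simp [shapePoly]
          linear_combination this
        · obtain ⟨t, rfl⟩ : ∃ t, b = t + 4 := ⟨b - 4, by omega⟩
          refine h.exists_lt (A := {s + 4, t + 4}) (B := 0) (P₀ := P') (C₀ := 0) (by simp)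
            (by simp) {3, s + t + 5} 0 (by simp) (by simp) (by simp) (by simp; omega) ?_
          refine coeffLT_of_eq_add
            ((CoeffPos.X.pow 4).mul ((pathSeq_pos s).mul (pathSeq_pos t))) ?_
          simp [shapePoly]
          linear_combination pathSeq_mul_eq_three s t
      · push Not at hb
        obtain ⟨j, rfl⟩ : ∃ j, P' = Multiset.replicate j 3 := ⟨_, Multiset.eq_replicate_card.2 hb⟩
        simp at hsum hcard
        -- All other paths are $P_3$, so counting vertices gives $l-k=s+1$; only odd $s\ge 5$ is not
        -- a listed shape.
        rcases (by omega : l = k + 4 ∨ ((l = k + 1 ∨ l = k + 2)) ∨ (k + 3 ≤ l ∧ (l - k) % 2 = 1) ∨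
          (4 ≤ s ∧ s % 2 = 1)) with hl | hl | hl | ⟨hs, ht⟩
        · left; right; right; right; left
          refine ⟨hl, ?_, rfl⟩
          rw [show s + 4 = 7 by omega, show k - 1 = j by omega, Multiset.add_comm]; rfl
        · left; right; left
          refine ⟨hl, ?_, rfl⟩
          rw [show s + 4 = l - k + 3 by omega, show k - 1 = j by omega, Multiset.add_comm]; rfl
        · left; right; right; right; right
          refine ⟨hl.1, hl.2, ?_, rfl⟩
          rw [show s + 4 = l - k + 3 by omega, show k - 1 = j by omega, Multiset.add_comm]; rfl
        · right
          obtain ⟨t, rfl⟩ := Nat.exists_eq_add_of_le' hs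
          -- The path breaks into $P_3$ and a cycle, which is even because $t$ is odd.
          refine h.exists_lt (A := {t + 4 + 4}) (B := 0) (P₀ := _) (C₀ := 0) (by simp; rfl)
            (by simp) {3} {t + 5} (by simp) (by simp; omega) (by simp) (by simp; omega) ?_
          refine coeffLT_of_eq_add ((CoeffPos.X.pow 4).mul (pathSeq_pos t)) ?_
          have := pathSeq_mul_cycleSeq' 3 t
          rw [show 3 + 2 + t = t + 5 by omega, show 2 * 3 + 2 + t = t + 4 + 4 by omega] at this
          simp [shapePoly]
          linear_combination -this
    · push Not at hm
      left; left
      obtain ⟨i, j, rfl⟩ := Multiset.exists_eq_replicate_add_replicate (s := P) (a := 3) (b := 2)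
        fun x hx => by have := hm x hx; have := h.two_le x hx; omega
      simp at hsum hcard
      refine ⟨by omega, ?_, rfl⟩
      rw [show l = i by omega, show k - i = j by omega]
  · obtain ⟨C, rfl⟩ := Multiset.exists_cons_of_mem hc
    have hc4 := h.cycle c (by simp)
    rcases Multiset.empty_or_exists_mem C with rfl | ⟨d, hd⟩
    · obtain ⟨s, rfl⟩ : ∃ s, c = s + 4 := ⟨c - 4, by omega⟩
      by_cases h2 : ∃ m ∈ P, m ≠ 3
      · right
        obtain ⟨m, hm, hm3⟩ := h2
        obtain ⟨P, rfl⟩ := Multiset.exists_cons_of_mem hm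
        have hm2 := h.two_le m hm
        -- An even path absorbs the cycle. An odd path has at least 5 vertices and hands all but
        -- three of them to the cycle, which stays even.
        rcases Nat.mod_two_eq_zero_or_one m with hpar | hpar
        · refine h.exists_lt (A := {m}) (B := {s + 4}) (P₀ := P) (C₀ := 0) (by simp)
            (by simp) {m + s + 4} 0 (by simp) (by simp) (by simp) (by simp; omega) ?_
          -- Either product identity applies according to which component is larger; sizes differing
          -- by one are excluded by parity.
          rcases le_total (s + 4) m with hle | hle
          · obtain ⟨t, rfl⟩ := Nat.exists_eq_add_of_le hle
            refine coeffLT_of_eq_add ((CoeffPos.X.pow (s + 4)).mul (pathSeq_pos t)) ?_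
            have := pathSeq_mul_cycleSeq t (s + 4)
            rw [Even.neg_pow (Nat.even_iff.2 hc4.2), show t + 2 * (s + 4) = s + 4 + t + s + 4 by ring,
              add_comm t] at this
            simp [shapePoly]
            linear_combination this
          · rcases hle.eq_or_lt with rfl | hlt
            · refine coeffLT_of_eq_add ((CoeffPos.X.pow (s + 4)).mul (pathSeq_pos 0)) ?_
              have := pathSeq_mul_cycleSeq 0 (s + 4)
              rw [Even.neg_pow (Nat.even_iff.2 hc4.2),
                show 0 + 2 * (s + 4) = s + 4 + s + 4 by ring, zero_add] at this
              simp [shapePoly]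
              linear_combination this
            · obtain ⟨t, ht⟩ := Nat.exists_eq_add_of_le (show m + 2 ≤ s + 4 by omega)
              refine coeffLT_of_eq_add ((CoeffPos.X.pow (m + 1)).mul (pathSeq_pos t)) ?_
              have := pathSeq_mul_cycleSeq' m t
              rw [Odd.neg_pow (Nat.odd_iff.2 (by omega)), ← ht,
                show 2 * m + 2 + t = m + s + 4 by omega] at this
              simp [shapePoly]
              linear_combination this
        · obtain ⟨t, rfl⟩ : ∃ t, m = t + 4 := ⟨m - 4, by omega⟩
          refine h.exists_lt (A := {t + 4}) (B := {s + 4}) (P₀ := P) (C₀ := 0) (by simp)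
            (by simp) {3} {t + s + 5} (by simp) (by simp; omega) (by simp) (by simp; omega) ?_
          refine coeffLT_of_eq_add
            ((CoeffPos.X.pow 4).mul ((pathSeq_pos t).mul (cycleSeq_pos s))) ?_
          simp [shapePoly]
          linear_combination pathSeq_mul_cycleSeq_eq_three t s
      · push Not at h2
        obtain ⟨j, rfl⟩ : ∃ j, P = Multiset.replicate j 3 := ⟨_, Multiset.eq_replicate_card.2 h2⟩
        simp at hsum hcard
        left; right; right; left
        refine ⟨by omega, by omega, ?_, ?_⟩
        · rw [hcard]
        · rw [show l - k = s + 4 by omega]; rfl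
    · right
      obtain ⟨C, rfl⟩ := Multiset.exists_cons_of_mem hd
      have hd4 := h.cycle d (by simp)
      refine h.exists_lt (A := 0) (B := {c, d}) (P₀ := P) (C₀ := C) (by simp)
        (by simp) 0 {c + d} (by simp) (by simp; omega) (by simp) (by simp) ?_
      simpa [shapePoly] using cycleSeq_add_coeffLT hc4.2 hd4.2

lemma GoodShape.isShapeH_or_exists_gt {n k l : ℕ} {P C : Multiset ℕ} (h : GoodShape n k P C)
    (hn : n = 2 * k + l) (hl : 2 ≤ l) : IsShapeH k l P C ∨
      ∃ P' C', GoodShape n k P' C' ∧ CoeffLT (shapePoly P C) (shapePoly P' C') := by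
  have hsum := h.sum
  have hcard := h.card
  by_cases h8 : ∃ c ∈ C, 8 ≤ c
  · right
    obtain ⟨c, hc, hc8⟩ := h8
    obtain ⟨C, rfl⟩ := Multiset.exists_cons_of_mem hc
    obtain ⟨t, rfl⟩ := Nat.exists_eq_add_of_le hc8
    have hce := h.cycle _ hc
    refine h.exists_gt (A := 0) (B := {8 + t}) (P₀ := P) (C₀ := C) (by simp)
      (by simp) 0 {4, t + 4} (by simp) (by simp; omega) (by simp) (by simp; omega) ?_
    refine coeffLT_of_eq_add ((CoeffPos.X.pow 4).mul (cycleSeq_pos t)) ?_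
    have := cycleSeq_mul t 4
    rw [show t + 2 * 4 = 8 + t by ring] at this
    simp [shapePoly]
    linear_combination this
  -- Only $C_4$ and $C_6$ remain. Two copies of $C_6$ are then traded for three of $C_4$.
  push Not at h8
  obtain ⟨q, r, rfl⟩ := Multiset.exists_eq_replicate_add_replicate (s := C) (a := 4) (b := 6)
    fun x hx => by have := h8 x hx; have := h.cycle x hx; omega
  rcases (by omega : 2 ≤ r ∨ r = 0 ∨ r = 1) with hr | hr
  · right
    obtain ⟨t, rfl⟩ := Nat.exists_eq_add_of_le hr
    refine h.exists_gt (A := 0) (B := {6, 6}) (P₀ := P)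
      (C₀ := Multiset.replicate q 4 + Multiset.replicate t 6) (by simp)
      (by rw [Multiset.replicate_add, ← add_assoc, add_comm (Multiset.replicate q 4), add_assoc]
          rfl)
      0 {4, 4, 4} (by simp) (by simp) (by simp) (by simp) ?_
    -- This is $3x^4+12x^5+4x^6$, written so that positivity follows from that of $1$, $2$ and $x$.
    refine coeffLT_of_eq_add (h := X ^ 3 * (X * (1 + 1 + 1 + X * (2 ^ 3 + 2 ^ 2 + X * 2 ^ 2)))) ?_ ?_
    · have h1 := CoeffPos.one
      have h2 := CoeffPos.two
      have hX := CoeffPos.X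
      exact (hX.pow 3).mul (hX.mul (((h1.add h1).add h1).add
        (hX.mul (((h2.pow 3).add (h2.pow 2)).add (hX.mul (h2.pow 2))))))
    · simp [shapePoly, cycleSeq]; ring
  by_cases hm : ∃ m ∈ P, m ≠ 2
  · obtain ⟨m, hm, hm2⟩ := hm
    have hm2' := h.two_le m hm
    obtain ⟨P, rfl⟩ := Multiset.exists_cons_of_mem hm
    -- Two paths on at least three vertices become $P_2$ and one longer path, so at most one path
    -- differs from $P_2$.
    by_cases hb : ∃ b ∈ P, b ≠ 2
    · right
      obtain ⟨b, hb, hb2⟩ := hb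
      have hb2' := h.two_le b (by simp [hb])
      obtain ⟨P, rfl⟩ := Multiset.exists_cons_of_mem hb
      obtain ⟨s, rfl⟩ := Nat.exists_eq_add_of_le (show 3 ≤ m by omega)
      obtain ⟨t, rfl⟩ := Nat.exists_eq_add_of_le (show 3 ≤ b by omega)
      refine h.exists_gt (A := {3 + s, 3 + t}) (B := 0) (P₀ := P) (by simp)
        (zero_add _).symm {2, s + t + 4} 0 (by simp) (by simp) (by simp) (by simp; omega) ?_
      refine coeffLT_of_eq_add
        ((CoeffPos.X.pow 3).mul ((pathSeq_pos s).mul (pathSeq_pos t))) ?_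
      simp [shapePoly, add_comm 3]
      linear_combination pathSeq_two_mul s t
    push Not at hb
    obtain ⟨j, rfl⟩ : ∃ j, P = Multiset.replicate j 2 := ⟨_, Multiset.eq_replicate_card.2 hb⟩
    by_cases hm8 : 8 ≤ m
    · right
      obtain ⟨t, rfl⟩ := Nat.exists_eq_add_of_le hm8
      refine h.exists_gt (A := {8 + t}) (B := 0) (P₀ := Multiset.replicate j 2) (by simp)
        (zero_add _).symm {t + 4} {4} (by simp) (by simp) (by simp) (by simp; omega) ?_
      refine coeffLT_of_eq_add ((CoeffPos.X.pow 4).mul (pathSeq_pos t)) ?_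
      have := pathSeq_mul_cycleSeq t 4
      rw [show t + 2 * 4 = 8 + t by ring] at this
      simp [shapePoly]
      linear_combination this
    have hj : k - 1 = j := by simp at hcard; omega
    have hX := CoeffPos.X
    have h1 := CoeffPos.one
    have h2 := CoeffPos.two
    -- Finitely many local configurations are left: one path on 3 to 7 vertices, copies of $C_4$,
    -- and at most one $C_6$.
    rcases (by omega : m = 6 ∨ m = 7 ∨ m = 3 ∨ m = 4 ∨ m = 5) with rfl | rfl | rfl | rfl | rfl
    · right
      refine h.exists_gt (A := {6}) (B := 0) (P₀ := Multiset.replicate j 2) (by simp)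
        (zero_add _).symm {2} {4} (by simp) (by simp) (by simp) (by simp) ?_
      refine coeffLT_of_eq_add (CoeffPos.X.pow 3) ?_
      simp [shapePoly, pathSeq, cycleSeq]; ring
    · rcases hr with rfl | rfl
      · left; right; right; right; right; left
        simp at hsum hcard
        refine ⟨by omega, by omega, ?_, ?_⟩
        · rw [hj, add_comm]; simp
        · rw [show (l - 5) / 4 = q by omega]; simp
      · right
        refine h.exists_gt (A := {7}) (B := {6}) (P₀ := Multiset.replicate j 2)
          (C₀ := Multiset.replicate q 4) (by simp) (by rw [add_comm]; simp)
          {5} {4, 4} (by simp) (by simp) (by simp) (by simp) ?_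
        refine coeffLT_of_eq_add ((h2.mul (hX.pow 4)).mul (cycleSeq_pos 4)) ?_
        simp [shapePoly, pathSeq, cycleSeq]; ring
    · rcases hr with rfl | rfl
      · left; right; right; right; left
        simp at hsum hcard
        refine ⟨by omega, by omega, ?_, ?_⟩
        · rw [hj, add_comm]; simp
        · rw [show (l - 1) / 4 = q by omega]; simp
      · right
        refine h.exists_gt (A := {3}) (B := {6}) (P₀ := Multiset.replicate j 2)
          (C₀ := Multiset.replicate q 4) (by simp) (by rw [add_comm]; simp)
          {5} {4} (by simp) (by simp) (by simp) (by simp) ?_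
        refine coeffLT_of_eq_add (h2.mul (hX.pow 4)) ?_
        simp [shapePoly, pathSeq, cycleSeq]; ring
    · rcases hr with rfl | rfl
      · rcases Nat.eq_zero_or_pos q with rfl | hq
        · left; left
          simp at hsum hcard
          refine ⟨by omega, ?_, by simp⟩
          rw [hj, add_comm]; simp
        · right
          obtain ⟨q, rfl⟩ := Nat.exists_eq_add_of_le' hq
          refine h.exists_gt (A := {4}) (B := {4}) (P₀ := Multiset.replicate j 2)
            (C₀ := Multiset.replicate q 4) (by simp) (by simp [Multiset.replicate_succ])
            {2} {6} (by simp) (by simp) (by simp) (by simp) ?_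
          refine coeffLT_of_eq_add (hX.pow 3) ?_
          simp [shapePoly, pathSeq, cycleSeq]; ring
      · right
        refine h.exists_gt (A := {4}) (B := {6}) (P₀ := Multiset.replicate j 2)
          (C₀ := Multiset.replicate q 4) (by simp) (by rw [add_comm]; simp)
          {2} {4, 4} (by simp) (by simp) (by simp) (by simp) ?_
        refine coeffLT_of_eq_add (h := X ^ 3 * (1 + X * (1 + 2 ^ 2 + 2 * X)))
          ((hX.pow 3).mul (h1.add (hX.mul ((h1.add (h2.pow 2)).add (h2.mul hX))))) ?_
        simp [shapePoly, pathSeq, cycleSeq]; ring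
    · rcases hr with rfl | rfl
      · left
        simp at hsum hcard
        rcases Nat.eq_zero_or_pos q with rfl | hq
        · right; left
          refine ⟨by omega, ?_, by simp⟩
          rw [hj, add_comm]; simp
        · right; right; right; right; right; right
          refine ⟨by omega, by omega, ?_, ?_⟩
          · rw [hj, add_comm]; simp
          · rw [show (l - 3) / 4 = q by omega]; simp
      · right
        refine h.exists_gt (A := {5}) (B := {6}) (P₀ := Multiset.replicate j 2)
          (C₀ := Multiset.replicate q 4) (by simp) (by rw [add_comm]; simp)
          {3} {4, 4} (by simp) (by simp) (by simp) (by simp) ?_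
        refine coeffLT_of_eq_add ((hX.pow 4).mul (pathSeq_pos 3)) ?_
        simp [shapePoly, pathSeq, cycleSeq]; ring
  · push Not at hm
    obtain ⟨j, rfl⟩ : ∃ j, P = Multiset.replicate j 2 := ⟨_, Multiset.eq_replicate_card.2 hm⟩
    simp at hsum hcard
    subst hcard
    left
    rcases hr with rfl | rfl
    · right; right; left
      refine ⟨by omega, by omega, rfl, ?_⟩
      rw [show l / 4 = q by omega]; simp
    · right; right; right; right; right; left
      refine ⟨by omega, by omega, rfl, ?_⟩
      rw [show (l - 6) / 4 = q by omega]; simp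

lemma IsShapeF.goodShape {n k l : ℕ} (hk : 1 ≤ k) (hn : n = 2 * k + l) {P C : Multiset ℕ}
    (h : IsShapeF k l P C) : GoodShape n k P C := by
  rcases h with ⟨_, rfl, rfl⟩ | ⟨_, rfl, rfl⟩ | ⟨_, _, rfl, rfl⟩ | ⟨_, rfl, rfl⟩ |
    ⟨_, _, rfl, rfl⟩ <;>
  (refine ⟨?_, ?_, by simp; try omega, by simp; try omega⟩ <;>
    simp [Multiset.mem_replicate, or_imp, forall_and] <;> omega)

lemma IsShapeH.goodShape {n k l : ℕ} (hk : 1 ≤ k) (hn : n = 2 * k + l) {P C : Multiset ℕ}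
    (h : IsShapeH k l P C) : GoodShape n k P C := by
  rcases h with ⟨_, rfl, rfl⟩ | ⟨_, rfl, rfl⟩ | ⟨_, _, rfl, rfl⟩ | ⟨_, _, rfl, rfl⟩ |
    ⟨_, _, rfl, rfl⟩ | ⟨_, _, rfl, rfl⟩ | ⟨_, _, rfl, rfl⟩ <;>
  (refine ⟨?_, ?_, by simp; try omega, by simp; try omega⟩ <;>
    simp [Multiset.mem_replicate, or_imp, forall_and])

lemma exists_isShapeF (k l : ℕ) : ∃ P C, IsShapeF k l P C := by
  by_cases h1 : l ≤ k
  · exact ⟨_, _, .inl ⟨h1, rfl, rfl⟩⟩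
  · by_cases h2 : l = k + 1 ∨ l = k + 2
    · exact ⟨_, _, .inr (.inl ⟨h2, rfl, rfl⟩)⟩
    · rcases Nat.mod_two_eq_zero_or_one (l - k) with h | h
      · exact ⟨_, _, .inr (.inr (.inl ⟨by omega, h, rfl, rfl⟩))⟩
      · exact ⟨_, _, .inr (.inr (.inr (.inr ⟨by omega, h, rfl, rfl⟩)))⟩

lemma exists_isShapeH (k : ℕ) {l : ℕ} (hl : 2 ≤ l) : ∃ P C, IsShapeH k l P C := by
  rcases (by omega : l = 2 ∨ l = 3 ∨ (4 ≤ l ∧ l % 4 = 0) ∨ (5 ≤ l ∧ l % 4 = 1) ∨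
    (6 ≤ l ∧ l % 4 = 2) ∨ (7 ≤ l ∧ l % 4 = 3)) with h | h | h | h | h | h
  · exact ⟨_, _, .inl ⟨h, rfl, rfl⟩⟩
  · exact ⟨_, _, .inr (.inl ⟨h, rfl, rfl⟩)⟩
  · exact ⟨_, _, .inr (.inr (.inl ⟨h.1, h.2, rfl, rfl⟩))⟩
  · exact ⟨_, _, .inr (.inr (.inr (.inl ⟨h.1, h.2, rfl, rfl⟩)))⟩
  · exact ⟨_, _, .inr (.inr (.inr (.inr (.inr (.inl ⟨h.1, h.2, rfl, rfl⟩)))))⟩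
  · exact ⟨_, _, .inr (.inr (.inr (.inr (.inr (.inr ⟨h.1, h.2, rfl, rfl⟩)))))⟩

/-! ### Matching polynomials of graphs: multiplicativity and edge deletion. -/

section MatchingPolynomial

variable {V W : Type*} [Fintype V] [Fintype W]

open Classical in
/-- The matchings of `G`, of any number of edges. -/
noncomputable def matchings (G : SimpleGraph V) : Finset (Finset (Sym2 V)) :=
  Finset.univ.filter fun M => IsMMatching G M.card M

/-- The generating polynomial of the matchings of a graph on any finite type. -/
noncomputable def genPoly (G : SimpleGraph V) : ℝ[X] := ∑ M ∈ matchings G, X ^ M.card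

lemma mem_matchings {G : SimpleGraph V} {M : Finset (Sym2 V)} : M ∈ matchings G ↔
    (∀ e ∈ M, e ∈ G.edgeSet) ∧ ∀ e ∈ M, ∀ f ∈ M, e ≠ f → ∀ v : V, ¬ (v ∈ e ∧ v ∈ f) := by
  classical
  rw [matchings, Finset.mem_filter]
  simp only [IsMMatching, Finset.mem_univ, true_and]

lemma IsMMatching.two_mul_le {G : SimpleGraph V} {m : ℕ} {M : Finset (Sym2 V)}
    (h : IsMMatching G m M) : 2 * m ≤ Fintype.card V := by
  classical
  obtain ⟨h1, rfl, h3⟩ := h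
  have : (M.biUnion Sym2.toFinset).card = M.card * 2 := by
    rw [Finset.card_biUnion, Finset.sum_const_nat]
    · intro e he
      exact Sym2.card_toFinset_of_not_isDiag _ (G.not_isDiag_of_mem_edgeSet (h1 e he))
    · intro e he f hf hef
      refine Finset.disjoint_left.2 fun v hv hv' => h3 e he f hf hef v ⟨?_, ?_⟩
      exacts [Sym2.mem_toFinset.1 hv, Sym2.mem_toFinset.1 hv']
  rw [mul_comm, ← this]
  exact Finset.card_le_univ _

lemma coeff_genPoly (G : SimpleGraph V) (m : ℕ) : (genPoly G).coeff m = matchingCount m G := by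
  classical
  rw [genPoly, finsetSum_coeff]
  simp only [coeff_X_pow]
  rw [Finset.sum_boole, matchingCount, ← Set.ncard_coe_finset]
  congr 2
  ext M
  simp only [Finset.coe_filter, mem_matchings, IsMMatching, Set.mem_ofPred_eq]
  tauto

/-- Truncation at $\lfloor n/2\rfloor$ loses nothing, since $m$ disjoint edges cover $2m$ vertices.
-/
lemma matchingPoly_eq_genPoly {n : ℕ} (G : SimpleGraph (Fin n)) : matchingPoly G = genPoly G := by
  ext m
  rw [coeff_genPoly, matchingPoly, finsetSum_coeff]
  simp only [coeff_C_mul, coeff_X_pow, mul_ite, mul_one, mul_zero, Finset.sum_ite_eq,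
    Finset.mem_range]
  split_ifs with h
  · rfl
  · have : {M : Finset (Sym2 (Fin n)) | IsMMatching G m M} = ∅ := by
      ext M
      simp only [Set.mem_ofPred_eq, Set.mem_empty_iff_false, iff_false]
      intro hM
      have := hM.two_mul_le
      rw [Fintype.card_fin] at this
      omega
    simp [matchingCount, this]

/-- An embedding only adds isolated vertices, which no matching meets. Smaller graphs can thus be
placed on the vertex set of a larger one. -/
lemma genPoly_map (G : SimpleGraph V) (f : V ↪ W) : genPoly (G.map f) = genPoly G := by
  classical
  symm
  refine Finset.sum_nbij (fun M => M.map f.sym2Map) ?_ ?_ ?_ ?_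
  · intro M hM
    rw [mem_matchings] at hM ⊢
    refine ⟨?_, ?_⟩
    · intro e he
      obtain ⟨e, he', rfl⟩ := Finset.mem_map.1 he
      rw [edgeSet_map]
      exact ⟨e, hM.1 e he', rfl⟩
    · intro _ he₀ _ he₀' hne w ⟨hw, hw'⟩
      obtain ⟨e, he, rfl⟩ := Finset.mem_map.1 he₀
      obtain ⟨e', he', rfl⟩ := Finset.mem_map.1 he₀'
      obtain ⟨v, hv, rfl⟩ := Sym2.mem_map.1 hw
      obtain ⟨v', hv', hvv⟩ := Sym2.mem_map.1 hw'
      rw [f.injective hvv] at hv'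
      exact hM.2 e he e' he' (fun h => hne (by rw [h])) v ⟨hv, hv'⟩
  · intro M _ N _ h
    exact Finset.map_injective _ h
  · intro N hN
    rw [Finset.mem_coe, mem_matchings] at hN
    have hsub : (N : Set (Sym2 W)) ⊆ Set.range f.sym2Map := by
      intro e he
      have := hN.1 e he
      rw [edgeSet_map] at this
      obtain ⟨e', _, rfl⟩ := this
      exact ⟨e', rfl⟩
    refine ⟨N.preimage f.sym2Map f.sym2Map.injective.injOn, ?_, ?_⟩
    · rw [Finset.mem_coe, mem_matchings]
      refine ⟨?_, ?_⟩
      · intro e he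
        have := hN.1 _ (Finset.mem_preimage.1 he)
        rw [edgeSet_map] at this
        obtain ⟨e', he', h⟩ := this
        rwa [← f.sym2Map.injective h]
      · intro e he e' he' hne v ⟨hv, hv'⟩
        exact hN.2 _ (Finset.mem_preimage.1 he) _ (Finset.mem_preimage.1 he')
          (fun h => hne (f.sym2Map.injective h)) (f v)
          ⟨Sym2.mem_map.2 ⟨v, hv, rfl⟩, Sym2.mem_map.2 ⟨v, hv', rfl⟩⟩
    · ext e
      simp only [Finset.mem_map, Finset.mem_preimage]
      constructor
      · rintro ⟨e', he', rfl⟩; exact he'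
      · intro he
        obtain ⟨e', rfl⟩ := hsub he
        exact ⟨e', he, rfl⟩
  · intro M _
    simp

lemma genPoly_congr {G : SimpleGraph V} {H : SimpleGraph W} (e : G ≃g H) :
    genPoly G = genPoly H := by
  rw [← genPoly_map G e.toEquiv.toEmbedding]
  congr 1
  ext a b
  rw [map_adj]
  constructor
  · rintro ⟨u, v, h, rfl, rfl⟩
    exact e.map_adj_iff.2 h
  · intro h
    exact ⟨e.symm a, e.symm b, e.symm.map_adj_iff.2 h, by simp, by simp⟩

lemma genPoly_sup {G H : SimpleGraph V}
    (hd : ∀ e ∈ G.edgeSet, ∀ f ∈ H.edgeSet, ∀ v, ¬ (v ∈ e ∧ v ∈ f)) :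
    genPoly (G ⊔ H) = genPoly G * genPoly H := by
  classical
  have hd' : ∀ e ∈ G.edgeSet, e ∉ H.edgeSet := by
    intro e he he'
    induction e with
    | h a b => exact hd _ he _ he' a ⟨by simp, by simp⟩
  simp only [genPoly]
  rw [Finset.sum_mul_sum, ← Finset.sum_product']
  symm
  refine Finset.sum_nbij' (fun p => p.1 ∪ p.2)
    (fun M => (M.filter (· ∈ G.edgeSet), M.filter (· ∈ H.edgeSet))) ?_ ?_ ?_ ?_ ?_
  · rintro ⟨M, N⟩ h
    simp only [Finset.mem_product, mem_matchings] at h ⊢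
    obtain ⟨⟨h1, h2⟩, h3, h4⟩ := h
    refine ⟨?_, ?_⟩
    · intro e he
      rw [edgeSet_sup]
      exact (Finset.mem_union.1 he).imp (h1 e) (h3 e)
    · intro e he f hf hef v hv
      rcases Finset.mem_union.1 he with he | he <;> rcases Finset.mem_union.1 hf with hf | hf
      · exact h2 e he f hf hef v hv
      · exact hd e (h1 e he) f (h3 f hf) v hv
      · exact hd f (h1 f hf) e (h3 e he) v hv.symm
      · exact h4 e he f hf hef v hv
  · intro M h
    simp only [Finset.mem_product, mem_matchings, Finset.mem_filter] at h ⊢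
    exact ⟨⟨fun e he => he.2, fun e he f hf => h.2 e he.1 f hf.1⟩,
      fun e he => he.2, fun e he f hf => h.2 e he.1 f hf.1⟩
  · rintro ⟨M, N⟩ h
    simp only [Finset.mem_product, mem_matchings] at h
    obtain ⟨⟨h1, _⟩, h3, _⟩ := h
    refine Prod.ext ?_ ?_
    · ext e
      simp only [Finset.mem_filter, Finset.mem_union]
      exact ⟨fun he => he.1.resolve_right fun h => hd' e he.2 (h3 e h),
        fun he => ⟨.inl he, h1 e he⟩⟩
    · ext e
      simp only [Finset.mem_filter, Finset.mem_union]
      exact ⟨fun he => he.1.resolve_left fun h => hd' e (h1 e h) he.2,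
        fun he => ⟨.inr he, h3 e he⟩⟩
  · intro M h
    rw [mem_matchings] at h
    ext e
    simp only [Finset.mem_filter, Finset.mem_union]
    constructor
    · rintro (h | h) <;> exact h.1
    · intro he
      have := h.1 e he
      rw [edgeSet_sup] at this
      exact this.imp (fun h => ⟨he, h⟩) fun h => ⟨he, h⟩
  · rintro ⟨M, N⟩ h
    simp only [Finset.mem_product, mem_matchings] at h
    rw [Finset.card_union_of_disjoint, pow_add]
    exact Finset.disjoint_left.2 fun e he he' => hd' e (h.1.1 e he) (h.2.1 e he')

lemma genPoly_sum (G : SimpleGraph V) (H : SimpleGraph W) :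
    genPoly (G ⊕g H) = genPoly G * genPoly H := by
  rw [← genPoly_map G (Function.Embedding.inl (β := W)),
    ← genPoly_map H (Function.Embedding.inr (α := V)), ← genPoly_sup]
  · congr 1
    ext a b
    rcases a with a | a <;> rcases b with b | b <;> simp [map_adj]
  · intro e he f hf v ⟨hv, hv'⟩
    rw [edgeSet_map] at he hf
    obtain ⟨e, _, rfl⟩ := he
    obtain ⟨f, _, rfl⟩ := hf
    obtain ⟨a, _, rfl⟩ := Sym2.mem_map.1 hv
    obtain ⟨b, _, h⟩ := Sym2.mem_map.1 hv'
    simp at h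

/-- Matchings are split by whether they contain $uv$; those that do correspond to matchings of `G₂`
by erasing $uv$. Vertices are isolated rather than removed, so all three graphs share `V`. -/
lemma genPoly_eq_add {G G₁ G₂ : SimpleGraph V} {u v : V} (huv : G.Adj u v)
    (h₁ : ∀ a b, G₁.Adj a b ↔ G.Adj a b ∧ s(a, b) ≠ s(u, v))
    (h₂ : ∀ a b, G₂.Adj a b ↔ G.Adj a b ∧ (a ≠ u ∧ a ≠ v) ∧ (b ≠ u ∧ b ≠ v)) :
    genPoly G = genPoly G₁ + X * genPoly G₂ := by
  classical
  have h₁' : ∀ e, e ∈ G₁.edgeSet ↔ e ∈ G.edgeSet ∧ e ≠ s(u, v) := by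
    intro e; induction e with
    | h a b => exact h₁ a b
  have h₂' : ∀ e, e ∈ G₂.edgeSet ↔ e ∈ G.edgeSet ∧ u ∉ e ∧ v ∉ e := by
    intro e; induction e with
    | h a b =>
      simp only [mem_edgeSet, h₂, Sym2.mem_iff]
      grind
  simp only [genPoly]
  rw [← Finset.sum_filter_add_sum_filter_not (matchings G) (fun M => s(u, v) ∉ M)]
  congr 1
  · refine Finset.sum_congr ?_ fun _ _ => rfl
    ext M
    simp only [Finset.mem_filter, mem_matchings, h₁']
    constructor
    · rintro ⟨⟨h1, h2⟩, h3⟩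
      exact ⟨fun e he => ⟨h1 e he, fun h => h3 (h ▸ he)⟩, h2⟩
    · rintro ⟨h1, h2⟩
      exact ⟨⟨fun e he => (h1 e he).1, h2⟩, fun h => (h1 _ h).2 rfl⟩
  · rw [Finset.mul_sum]
    symm
    have hnot : ∀ M ∈ matchings G₂, s(u, v) ∉ M := by
      intro M hM h
      exact ((h₂' _).1 ((mem_matchings.1 hM).1 _ h)).2.1 (by simp)
    refine Finset.sum_nbij' (fun M => insert s(u, v) M) (fun M => M.erase s(u, v))
      ?_ ?_ ?_ ?_ ?_
    · intro M hM
      rw [mem_matchings] at hM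
      obtain ⟨h1, h2⟩ := hM
      simp only [Finset.mem_filter, mem_matchings, not_not]
      have key : ∀ e ∈ M, ∀ w, w ∈ s(u, v) → w ∉ e := by
        intro e he w hw
        rcases Sym2.mem_iff.1 hw with rfl | rfl
        exacts [((h₂' e).1 (h1 e he)).2.1, ((h₂' e).1 (h1 e he)).2.2]
      refine ⟨⟨?_, ?_⟩, Finset.mem_insert_self _ _⟩
      · intro e he
        rcases Finset.mem_insert.1 he with rfl | he
        exacts [huv, ((h₂' e).1 (h1 e he)).1]
      · intro e he f hf hef w hw
        rcases Finset.mem_insert.1 he with rfl | he <;> rcases Finset.mem_insert.1 hf with rfl | hf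
        · exact hef rfl
        · exact key f hf w hw.1 hw.2
        · exact key e he w hw.2 hw.1
        · exact h2 e he f hf hef w hw
    · intro M hM
      simp only [Finset.mem_filter, mem_matchings, not_not] at hM
      obtain ⟨⟨h1, h2⟩, h3⟩ := hM
      simp only [mem_matchings, Finset.mem_erase, h₂']
      refine ⟨fun e he => ⟨h1 e he.2, ?_, ?_⟩, fun e he f hf => h2 e he.2 f hf.2⟩
      · exact fun h => h2 e he.2 _ h3 he.1 u ⟨h, by simp⟩
      · exact fun h => h2 e he.2 _ h3 he.1 v ⟨h, by simp⟩
    · intro M hM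
      exact Finset.erase_insert (hnot M hM)
    · intro M hM
      simp only [Finset.mem_filter, not_not] at hM
      exact Finset.insert_erase hM.2
    · intro M hM
      rw [Finset.card_insert_of_notMem (hnot M hM), pow_succ']

lemma genPoly_bot : genPoly (⊥ : SimpleGraph V) = 1 := by
  have : matchings (⊥ : SimpleGraph V) = {∅} := by
    ext M
    simp only [mem_matchings, edgeSet_bot, Set.mem_empty_iff_false, Finset.mem_singleton]
    constructor
    · exact fun h => Finset.eq_empty_of_forall_notMem fun e he => h.1 e he
    · rintro rfl; simp
  simp [genPoly, this]

end MatchingPolynomial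

lemma genPoly_pathGraph (n : ℕ) : genPoly (pathGraph n) = pathSeq n := by
  induction n using Nat.twoStepInduction with
  | zero => rw [Subsingleton.elim (pathGraph 0) ⊥, genPoly_bot, pathSeq_zero]
  | one => rw [Subsingleton.elim (pathGraph 1) ⊥, genPoly_bot, pathSeq_one]
  | more n h h' =>
    rw [pathSeq_add_two, ← h, ← h', ← genPoly_map (pathGraph n) (Fin.castLEEmb (n.le_add_right 2)),
      ← genPoly_map (pathGraph (n + 1)) (Fin.castLEEmb (n + 1).le_succ)]
    refine genPoly_eq_add (u := ⟨n, by omega⟩) (v := ⟨n + 1, by omega⟩) ?_ ?_ ?_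
    · simp [pathGraph_adj]
    · intro a b
      simp only [map_adj, pathGraph_adj, ne_eq, Sym2.eq_iff, Fin.ext_iff, Fin.castLEEmb_apply,
        Fin.val_castLE]
      constructor
      · rintro ⟨x, y, h, hx, hy⟩; omega
      · intro h
        exact ⟨⟨a, by omega⟩, ⟨b, by omega⟩, by simpa using h.1, rfl, rfl⟩
    · intro a b
      simp only [map_adj, pathGraph_adj, ne_eq, Fin.ext_iff, Fin.castLEEmb_apply,
        Fin.val_castLE]
      constructor
      · rintro ⟨x, y, h, hx, hy⟩; omega
      · intro h
        exact ⟨⟨a, by omega⟩, ⟨b, by omega⟩, by simpa using h.1, rfl, rfl⟩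

lemma cycleGraph_adj_iff_val {n : ℕ} {u v : Fin (n + 3)} : (cycleGraph (n + 3)).Adj u v ↔
    u.val + 1 = v.val ∨ v.val + 1 = u.val ∨ (u.val = 0 ∧ v.val = n + 2) ∨
      (v.val = 0 ∧ u.val = n + 2) := by
  rw [cycleGraph_adj']
  have hu := u.2
  have hv := v.2
  rcases lt_trichotomy u v with h | h | h
  · rw [Fin.coe_sub_iff_lt.2 h, Fin.coe_sub_iff_le.2 h.le]
    rw [Fin.lt_def] at h
    omega
  · subst h; simp only [sub_self, Fin.val_zero]; omega
  · rw [Fin.coe_sub_iff_lt.2 h, Fin.coe_sub_iff_le.2 h.le]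
    rw [Fin.lt_def] at h
    omega

/-- Deletion of the closing edge leaves the path on all vertices; isolating its ends leaves the path
on the inner ones. -/
lemma genPoly_cycleGraph (n : ℕ) : genPoly (cycleGraph (n + 3)) = cycleSeq (n + 3) := by
  rw [cycleSeq_eq_pathSeq, ← genPoly_pathGraph, ← genPoly_pathGraph,
    ← genPoly_map (pathGraph (n + 1))
      ((Fin.succEmb (n + 1)).trans (Fin.castLEEmb (n + 2).le_succ))]
  refine genPoly_eq_add (u := ⟨0, by omega⟩) (v := ⟨n + 2, by omega⟩) ?_ ?_ ?_
  · simp [cycleGraph_adj_iff_val]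
  · intro a b
    simp only [pathGraph_adj, cycleGraph_adj_iff_val, ne_eq, Sym2.eq_iff, Fin.ext_iff]
    omega
  · intro a b
    simp only [map_adj, pathGraph_adj, cycleGraph_adj_iff_val, ne_eq, Fin.ext_iff,
      Function.Embedding.trans_apply, Fin.castLEEmb_apply, Fin.val_castLE, Fin.coe_succEmb,
      Fin.val_succ]
    constructor
    · rintro ⟨x, y, h, hx, hy⟩; omega
    · intro h
      exact ⟨⟨a - 1, by omega⟩, ⟨b - 1, by omega⟩, by simp only; omega, by simp only; omega,
        by simp only; omega⟩

/-! ### Disjoint unions of paths and cycles up to isomorphism. -/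

section Shape

/-- The vertices of a disjoint union of graphs with the numbers of vertices given by a list. -/
def UnionVert : List ℕ → Type
  | [] => Fin 0
  | a :: L => Fin a ⊕ UnionVert L

noncomputable instance UnionVert.fintype : (L : List ℕ) → Fintype (UnionVert L)
  | [] => inferInstanceAs (Fintype (Fin 0))
  | a :: L => @instFintypeSum (Fin a) (UnionVert L) _ (UnionVert.fintype L)

/-- The disjoint union of the graphs `f a`, where `a` runs through a list. -/
def unionGraph (f : (n : ℕ) → SimpleGraph (Fin n)) : (L : List ℕ) → SimpleGraph (UnionVert L)
  | [] => (⊥ : SimpleGraph (Fin 0))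
  | a :: L => f a ⊕g unionGraph f L

variable {V W U : Type}

/-- The disjoint union with a graph on no vertices. -/
def sumIsEmptyIso [IsEmpty W] (G : SimpleGraph V) (H : SimpleGraph W) : G ⊕g H ≃g G where
  toEquiv := Equiv.sumEmpty V W
  map_rel_iff' := by rintro (a | a) (b | b) <;> first | exact isEmptyElim a | exact isEmptyElim b | simp

lemma card_unionVert (L : List ℕ) : Fintype.card (UnionVert L) = L.sum := by
  induction L with
  | nil => rfl
  | cons a L ih =>
    rw [List.sum_cons, ← ih]
    exact (Fintype.card_sum (α := Fin a) (β := UnionVert L)).trans (by rw [Fintype.card_fin])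

lemma unionGraph_perm (f : (n : ℕ) → SimpleGraph (Fin n)) {L M : List ℕ} (h : L.Perm M) :
    Nonempty (unionGraph f L ≃g unionGraph f M) := by
  induction h with
  | nil => exact ⟨Iso.refl⟩
  | cons x _ ih => exact ih.map fun e => Iso.sumCongr Iso.refl e
  | swap x y L =>
    exact ⟨(Iso.sumAssoc.symm.trans (Iso.sumCongr Iso.sumComm Iso.refl)).trans Iso.sumAssoc⟩
  | trans _ _ ih ih' => exact ⟨ih.some.trans ih'.some⟩

lemma unionGraph_append (f : (n : ℕ) → SimpleGraph (Fin n)) (L M : List ℕ) :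
    Nonempty (unionGraph f (L ++ M) ≃g unionGraph f L ⊕g unionGraph f M) := by
  induction L with
  | nil =>
    have : IsEmpty (UnionVert []) := inferInstanceAs (IsEmpty (Fin 0))
    exact ⟨((Iso.sumComm).trans (sumIsEmptyIso _ _)).symm⟩
  | cons a L ih => exact ih.map fun e => (Iso.sumCongr Iso.refl e).trans Iso.sumAssoc.symm

/-- `G` is the disjoint union of paths and cycles with sizes given by `P` and `C`. -/
def HasShape (G : SimpleGraph V) (P C : Multiset ℕ) : Prop :=
  ∃ L M : List ℕ, (L : Multiset ℕ) = P ∧ (M : Multiset ℕ) = C ∧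
    Nonempty (G ≃g unionGraph pathGraph L ⊕g unionGraph cycleGraph M)

lemma HasShape.congr {G : SimpleGraph V} {H : SimpleGraph W} {P C : Multiset ℕ}
    (h : HasShape G P C) (e : Nonempty (H ≃g G)) : HasShape H P C := by
  obtain ⟨L, M, h1, h2, ⟨i⟩⟩ := h
  exact ⟨L, M, h1, h2, ⟨e.some.trans i⟩⟩

lemma HasShape.nonempty_iso {G : SimpleGraph V} {H : SimpleGraph W} {P C : Multiset ℕ}
    (h : HasShape G P C) (h' : HasShape H P C) : Nonempty (G ≃g H) := by
  obtain ⟨L, M, rfl, rfl, ⟨i⟩⟩ := h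
  obtain ⟨L', M', h1, h2, ⟨j⟩⟩ := h'
  obtain ⟨e⟩ := unionGraph_perm pathGraph (Multiset.coe_eq_coe.1 h1)
  obtain ⟨e'⟩ := unionGraph_perm cycleGraph (Multiset.coe_eq_coe.1 h2)
  exact ⟨i.trans (j.trans (Iso.sumCongr e e')).symm⟩

/-- Turns the isomorphism conditions of the two lists into conditions on multisets of sizes.
Uniqueness of the decomposition is not involved. -/
lemma HasShape.iff_isoTo {G : SimpleGraph V} {H : SimpleGraph W} {P C : Multiset ℕ}
    (h : HasShape H P C) : HasShape G P C ↔ IsoTo G H :=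
  ⟨fun h' => h'.nonempty_iso h, fun e => h.congr e⟩

lemma HasShape.sum {G : SimpleGraph V} {H : SimpleGraph W} {P C P' C' : Multiset ℕ}
    (h : HasShape G P C) (h' : HasShape H P' C') : HasShape (G ⊕g H) (P + P') (C + C') := by
  obtain ⟨L, M, rfl, rfl, ⟨i⟩⟩ := h
  obtain ⟨L', M', rfl, rfl, ⟨j⟩⟩ := h'
  obtain ⟨e⟩ := unionGraph_append pathGraph L L'
  obtain ⟨e'⟩ := unionGraph_append cycleGraph M M'
  refine ⟨L ++ L', M ++ M', rfl, rfl, ⟨(Iso.sumCongr i j).trans ?_⟩⟩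
  refine RelIso.trans ?_ (Iso.sumCongr e e').symm
  refine Iso.sumAssoc.trans ((Iso.sumCongr Iso.refl ?_).trans Iso.sumAssoc.symm)
  exact (Iso.sumAssoc.symm.trans (Iso.sumCongr Iso.sumComm Iso.refl)).trans Iso.sumAssoc

lemma HasShape.of_isEmpty [IsEmpty V] (G : SimpleGraph V) : HasShape G 0 0 :=
  haveI : IsEmpty (UnionVert []) := inferInstanceAs (IsEmpty (Fin 0))
  haveI : IsEmpty (UnionVert [] ⊕ UnionVert []) := inferInstance
  ⟨[], [], rfl, rfl, ⟨⟨Equiv.equivOfIsEmpty _ _, fun {a} => isEmptyElim a⟩⟩⟩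

lemma hasShape_pathGraph (n : ℕ) : HasShape (pathGraph n) {n} 0 :=
  haveI : IsEmpty (UnionVert []) := inferInstanceAs (IsEmpty (Fin 0))
  ⟨[n], [], rfl, rfl, ⟨((sumIsEmptyIso _ _).trans (sumIsEmptyIso _ _)).symm⟩⟩

lemma hasShape_cycleGraph (n : ℕ) : HasShape (cycleGraph n) 0 {n} :=
  haveI : IsEmpty (UnionVert []) := inferInstanceAs (IsEmpty (Fin 0))
  ⟨[], [n], rfl, rfl, ⟨((Iso.sumComm.trans (sumIsEmptyIso _ _)).trans (sumIsEmptyIso _ _)).symm⟩⟩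

/-- Splitting off one of the copies. -/
def copiesSuccIso (q : ℕ) (G : SimpleGraph V) : copies (q + 1) G ≃g G ⊕g copies q G where
  toFun x := Fin.cases (motive := fun _ => V ⊕ (Fin q × V)) (.inl x.2) (fun i => .inr (i, x.2)) x.1
  invFun := Sum.elim (fun v => (0, v)) fun x => (x.1.succ, x.2)
  left_inv := by
    rintro ⟨i, v⟩
    induction i using Fin.cases <;> rfl
  right_inv := by rintro (v | ⟨i, v⟩) <;> rfl
  map_rel_iff' := by
    rintro ⟨i, v⟩ ⟨j, w⟩
    induction i using Fin.cases <;> induction j using Fin.cases <;>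
      simp [copies, (Fin.succ_ne_zero _).symm]

lemma HasShape.copies {G : SimpleGraph V} {P C : Multiset ℕ} (h : HasShape G P C) (q : ℕ) :
    HasShape (copies q G) (q • P) (q • C) := by
  induction q with
  | zero => rw [zero_smul, zero_smul]; exact .of_isEmpty _
  | succ q ih =>
    rw [succ_nsmul', succ_nsmul']
    exact (h.sum ih).congr ⟨copiesSuccIso q G⟩

lemma hasShape_copies_pathGraph (q n : ℕ) :
    HasShape (copies q (pathGraph n)) (Multiset.replicate q n) 0 := by
  simpa [Multiset.nsmul_singleton] using (hasShape_pathGraph n).copies q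

lemma hasShape_copies_cycleGraph (q n : ℕ) :
    HasShape (copies q (cycleGraph n)) 0 (Multiset.replicate q n) := by
  simpa [Multiset.nsmul_singleton] using (hasShape_cycleGraph n).copies q

lemma exists_hasShape_of_sum {n : ℕ} {P C : Multiset ℕ} (h : P.sum + C.sum = n) :
    ∃ G : SimpleGraph (Fin n), HasShape G P C := by
  induction P using Quotient.inductionOn with | h L => ?_
  induction C using Quotient.inductionOn with | h M => ?_
  have e : UnionVert L ⊕ UnionVert M ≃ Fin n := Fintype.equivFinOfCardEq (by
    rw [Fintype.card_sum, card_unionVert, card_unionVert, ← h]; simp)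
  exact ⟨_, L, M, rfl, rfl, ⟨(Iso.map e _).symm⟩⟩

lemma genPoly_unionGraph (f : (n : ℕ) → SimpleGraph (Fin n)) (L : List ℕ) :
    genPoly (unionGraph f L) = (L.map fun a => genPoly (f a)).prod := by
  induction L with
  | nil => exact genPoly_bot
  | cons a L ih =>
    rw [List.map_cons, List.prod_cons, ← ih]
    exact genPoly_sum (f a) (unionGraph f L)

/-- Sizes below 3 must be excluded: for example `cycleSeq 2` is $1+2x$, but a simple graph on two
vertices has at most one edge. -/
lemma HasShape.genPoly_eq [Fintype V] {G : SimpleGraph V} {P C : Multiset ℕ} (h : HasShape G P C)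
    (hC : ∀ c ∈ C, 3 ≤ c) : genPoly G = shapePoly P C := by
  obtain ⟨L, M, rfl, rfl, ⟨i⟩⟩ := h
  rw [genPoly_congr i, genPoly_sum, genPoly_unionGraph, genPoly_unionGraph, shapePoly]
  simp only [genPoly_pathGraph, Multiset.map_coe, Multiset.prod_coe]
  congr 2
  refine List.map_congr_left fun c hc => ?_
  obtain ⟨c, rfl⟩ := Nat.exists_eq_add_of_le' (hC c (by simpa using hc))
  exact genPoly_cycleGraph c

lemma HasShape.card_eq [Fintype V] {G : SimpleGraph V} {P C : Multiset ℕ} (h : HasShape G P C) :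
    P.sum + C.sum = Fintype.card V := by
  obtain ⟨L, M, rfl, rfl, ⟨i⟩⟩ := h
  rw [Fintype.card_congr i.toEquiv, Fintype.card_sum, card_unionVert, card_unionVert]
  simp

end Shape

/-! ### Degrees, leaves and bipartiteness of a shape. -/

section Degrees

variable {V W : Type}

/-- All vertices have one or two neighbours. -/
def DegOneOrTwo (G : SimpleGraph V) : Prop :=
  ∀ v, (G.neighborSet v).ncard = 1 ∨ (G.neighborSet v).ncard = 2

/-- The number of vertices with exactly one neighbour. -/
noncomputable def leafCount (G : SimpleGraph V) : ℕ := {v | (G.neighborSet v).ncard = 1}.ncard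

lemma ncard_neighborSet_iso {G : SimpleGraph V} {H : SimpleGraph W} (e : G ≃g H) (v : V) :
    (H.neighborSet (e v)).ncard = (G.neighborSet v).ncard := by
  rw [← Set.ncard_image_of_injective _ e.injective]
  congr 1
  ext w
  constructor
  · intro h
    exact ⟨e.symm w, e.map_adj_iff.1 (by simpa using h), by simp⟩
  · rintro ⟨u, hu, rfl⟩
    exact e.map_adj_iff.2 hu

lemma ncard_neighborSet_inl (G : SimpleGraph V) (H : SimpleGraph W) (v : V) :
    ((G ⊕g H).neighborSet (.inl v)).ncard = (G.neighborSet v).ncard := by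
  rw [neighborSet_sum_inl, Set.ncard_image_of_injective _ Sum.inl_injective]

lemma ncard_neighborSet_inr (G : SimpleGraph V) (H : SimpleGraph W) (w : W) :
    ((G ⊕g H).neighborSet (.inr w)).ncard = (H.neighborSet w).ncard := by
  rw [neighborSet_sum_inr, Set.ncard_image_of_injective _ Sum.inr_injective]

lemma degOneOrTwo_congr {G : SimpleGraph V} {H : SimpleGraph W} (e : G ≃g H) :
    DegOneOrTwo G ↔ DegOneOrTwo H := by
  rw [DegOneOrTwo, DegOneOrTwo, e.surjective.forall]
  simp only [ncard_neighborSet_iso]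

lemma degOneOrTwo_sum {G : SimpleGraph V} {H : SimpleGraph W} :
    DegOneOrTwo (G ⊕g H) ↔ DegOneOrTwo G ∧ DegOneOrTwo H := by
  simp only [DegOneOrTwo, Sum.forall, ncard_neighborSet_inl, ncard_neighborSet_inr]

lemma leafCount_congr {G : SimpleGraph V} {H : SimpleGraph W} (e : G ≃g H) :
    leafCount G = leafCount H := by
  rw [leafCount, leafCount, ← Set.ncard_image_of_injective _ e.injective]
  congr 1
  ext w
  obtain ⟨v, rfl⟩ := e.surjective w
  simp only [e.injective.mem_set_image, Set.mem_ofPred_eq, ncard_neighborSet_iso]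

lemma leafCount_sum [Finite V] [Finite W] (G : SimpleGraph V) (H : SimpleGraph W) :
    leafCount (G ⊕g H) = leafCount G + leafCount H := by
  rw [leafCount, leafCount, leafCount,
    ← Set.ncard_image_of_injective {v | (G.neighborSet v).ncard = 1} (Sum.inl_injective (β := W)),
    ← Set.ncard_image_of_injective {w | (H.neighborSet w).ncard = 1} (Sum.inr_injective (α := V)),
    ← Set.ncard_union_eq]
  · congr 1
    ext (v | v) <;> simp [-Set.ncard_eq_one, ncard_neighborSet_inl, ncard_neighborSet_inr]
  · rw [Set.disjoint_left]
    rintro _ ⟨v, _, rfl⟩ ⟨w, _, h⟩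
    cases h

lemma degOneOrTwo_unionGraph (f : (n : ℕ) → SimpleGraph (Fin n)) (L : List ℕ) :
    DegOneOrTwo (unionGraph f L) ↔ ∀ a ∈ L, DegOneOrTwo (f a) := by
  induction L with
  | nil => simp only [List.not_mem_nil, false_imp_iff, implies_true, iff_true]; exact fun v => v.elim0
  | cons a L ih =>
    rw [List.forall_mem_cons, ← ih]
    exact degOneOrTwo_sum

lemma leafCount_unionGraph (f : (n : ℕ) → SimpleGraph (Fin n)) (L : List ℕ) :
    leafCount (unionGraph f L) = (L.map fun a => leafCount (f a)).sum := by
  induction L with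
  | nil =>
    have : IsEmpty (UnionVert []) := inferInstanceAs (IsEmpty (Fin 0))
    rw [leafCount, Set.eq_empty_of_isEmpty (Set.ofPred _)]; simp
  | cons a L ih =>
    rw [List.map_cons, List.sum_cons, ← ih]
    exact leafCount_sum (f a) (unionGraph f L)

lemma isBipartite_unionGraph (f : (n : ℕ) → SimpleGraph (Fin n)) (L : List ℕ) :
    (unionGraph f L).IsBipartite ↔ ∀ a ∈ L, (f a).IsBipartite := by
  induction L with
  | nil =>
    simp only [List.not_mem_nil, false_imp_iff, implies_true, iff_true]
    exact ⟨⟨fun v => v.elim0, fun {v} => v.elim0⟩⟩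
  | cons a L ih =>
    rw [List.forall_mem_cons, ← ih]
    exact colorable_sum

lemma isBipartite_congr {G : SimpleGraph V} {H : SimpleGraph W} (e : G ≃g H) :
    G.IsBipartite ↔ H.IsBipartite :=
  ⟨fun h => Colorable.of_hom e.symm.toHom h, fun h => Colorable.of_hom e.toHom h⟩

lemma ncard_neighborSet_pathGraph {n : ℕ} (v : Fin (n + 2)) :
    ((pathGraph (n + 2)).neighborSet v).ncard = if v = 0 ∨ v = Fin.last (n + 1) then 1 else 2 := by
  by_cases h0 : v = 0
  · subst h0
    rw [if_pos (.inl rfl), Set.ncard_eq_one]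
    refine ⟨⟨1, by omega⟩, ?_⟩
    ext w
    simp only [mem_neighborSet, pathGraph_adj, Set.mem_singleton_iff, Fin.ext_iff, Fin.val_zero]
    omega
  by_cases h1 : v = Fin.last (n + 1)
  · rw [if_pos (.inr h1), Set.ncard_eq_one]
    refine ⟨⟨n, by omega⟩, ?_⟩
    ext w
    have := w.2
    simp [pathGraph_adj, h1, Fin.ext_iff]
    omega
  · rw [if_neg (by tauto), Set.ncard_eq_two]
    rw [Fin.ext_iff] at h0 h1
    simp only [Fin.val_zero, Fin.val_last] at h0 h1
    have := v.2
    refine ⟨⟨v - 1, by omega⟩, ⟨v + 1, by omega⟩, ?_, ?_⟩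
    · simp only [ne_eq, Fin.mk.injEq]; omega
    · ext w
      simp only [mem_neighborSet, pathGraph_adj, Set.mem_insert_iff, Set.mem_singleton_iff,
        Fin.ext_iff]
      omega

lemma degOneOrTwo_pathGraph (n : ℕ) : DegOneOrTwo (pathGraph (n + 2)) := by
  intro v
  rw [ncard_neighborSet_pathGraph]
  split_ifs <;> simp

lemma leafCount_pathGraph (n : ℕ) : leafCount (pathGraph (n + 2)) = 2 := by
  rw [leafCount, Set.ncard_eq_two]
  refine ⟨0, Fin.last (n + 1), (Fin.last_pos).ne, ?_⟩
  ext v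
  simp only [ncard_neighborSet_pathGraph, Set.mem_ofPred_eq, Set.mem_insert_iff,
    Set.mem_singleton_iff]
  split_ifs with h <;> simp [h]

lemma not_degOneOrTwo_pathGraph_one : ¬ DegOneOrTwo (pathGraph 1) := by
  intro h
  have : (pathGraph 1).neighborSet 0 = ∅ := by
    ext w
    simp
  have h0 := h 0
  rw [this] at h0
  simp at h0

lemma ncard_neighborSet_cycleGraph {n : ℕ} (v : Fin (n + 3)) :
    ((cycleGraph (n + 3)).neighborSet v).ncard = 2 := by
  rw [Set.ncard_eq_toFinset_card', ← neighborFinset_def, card_neighborFinset_eq_degree,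
    cycleGraph_degree_three_le]

lemma leafCount_cycleGraph (n : ℕ) : leafCount (cycleGraph (n + 3)) = 0 := by
  simp [leafCount, ncard_neighborSet_cycleGraph]

lemma isBipartite_pathGraph (n : ℕ) : (pathGraph n).IsBipartite :=
  (pathGraph.bicoloring n).colorable

lemma isBipartite_cycleGraph_iff {n : ℕ} (hn : 3 ≤ n) :
    (cycleGraph n).IsBipartite ↔ n % 2 = 0 := by
  constructor
  · intro h
    by_contra hodd
    have := chromaticNumber_cycleGraph_of_odd n (by omega) (Nat.odd_iff.2 (by omega))
    have h' := chromaticNumber_le_iff_colorable.2 h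
    rw [this] at h'
    exact absurd h' (by decide)
  · intro h
    exact (cycleGraph.bicoloring_of_even n (Nat.even_iff.2 h)).colorable

lemma List.sum_map_eq_card_mul {L : List ℕ} {f : ℕ → ℕ} {c : ℕ} (h : ∀ a ∈ L, f a = c) :
    (L.map f).sum = L.length * c := by
  rw [List.map_congr_left h]; simp

/-- The degree condition rules out one-vertex paths, $2k$ leaves mean $k$ paths, and bipartiteness
means even cycles. -/
lemma HasShape.goodShape_iff {n : ℕ} {G : SimpleGraph (Fin n)} {P C : Multiset ℕ} {k : ℕ}
    (h : HasShape G P C) (hP : ∀ a ∈ P, 1 ≤ a) (hC : ∀ c ∈ C, 3 ≤ c) :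
    (G.IsBipartite ∧ leafCount G = 2 * k ∧ DegOneOrTwo G) ↔ GoodShape n k P C := by
  have hcard := h.card_eq
  rw [Fintype.card_fin] at hcard
  obtain ⟨L, M, rfl, rfl, ⟨i⟩⟩ := h
  simp only [Multiset.mem_coe] at hP hC
  have hsplit : (unionGraph pathGraph L ⊕g unionGraph cycleGraph M).IsBipartite ↔
      (unionGraph pathGraph L).IsBipartite ∧ (unionGraph cycleGraph M).IsBipartite := colorable_sum
  have hM : leafCount (unionGraph cycleGraph M) = 0 := by
    rw [leafCount_unionGraph, List.sum_map_eq_card_mul (c := 0), mul_zero]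
    intro c hc
    obtain ⟨c, rfl⟩ := Nat.exists_eq_add_of_le' (hC c hc)
    exact leafCount_cycleGraph c
  have hL (h2 : ∀ a ∈ L, 2 ≤ a) : leafCount (unionGraph pathGraph L) = 2 * L.length := by
    rw [leafCount_unionGraph, List.sum_map_eq_card_mul (c := 2), mul_comm]
    intro c hc
    obtain ⟨c, rfl⟩ := Nat.exists_eq_add_of_le' (h2 c hc)
    exact leafCount_pathGraph c
  rw [isBipartite_congr i, leafCount_congr i, degOneOrTwo_congr i, hsplit, leafCount_sum,
    degOneOrTwo_sum, degOneOrTwo_unionGraph, degOneOrTwo_unionGraph, isBipartite_unionGraph,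
    isBipartite_unionGraph, hM]
  constructor
  · rintro ⟨⟨_, hb⟩, hl, hd, _⟩
    have h2 : ∀ a ∈ L, 2 ≤ a := by
      intro a ha
      have h1 := hP a ha
      rcases h1.eq_or_lt with rfl | h1
      · exact absurd (hd _ ha) not_degOneOrTwo_pathGraph_one
      · exact h1
    rw [hL h2] at hl
    refine ⟨h2, fun c hc => ?_, by simp; omega, hcard⟩
    have h3 := hC c hc
    have := (isBipartite_cycleGraph_iff h3).1 (hb c hc)
    omega
  · rintro ⟨h2, hc, hcl, _⟩
    simp only [Multiset.mem_coe, Multiset.coe_card] at h2 hc hcl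
    refine ⟨⟨fun a _ => isBipartite_pathGraph a, fun c hcM =>
      (isBipartite_cycleGraph_iff (hC c hcM)).2 (hc c hcM).2⟩, by rw [hL h2, hcl, add_zero],
      fun a ha => ?_, fun c hcM => ?_⟩
    · obtain ⟨a, rfl⟩ := Nat.exists_eq_add_of_le' (h2 a ha)
      exact degOneOrTwo_pathGraph a
    · obtain ⟨c, rfl⟩ := Nat.exists_eq_add_of_le' (hC c hcM)
      exact fun v => .inr (ncard_neighborSet_cycleGraph v)

lemma mem_OmegaBi_iff {n k : ℕ} {G : SimpleGraph (Fin n)} :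
    G ∈ OmegaBi n k ↔ G.IsBipartite ∧ leafCount G = 2 * k ∧ DegOneOrTwo G := by
  classical
  have hd (v : Fin n) : (G.neighborSet v).ncard = G.degree v := by
    rw [Set.ncard_eq_toFinset_card', ← neighborFinset_def, card_neighborFinset_eq_degree]
  have hl : leafCount G = (Finset.univ.filter fun v => G.degree v = 1).card := by
    rw [leafCount, ← Set.ncard_coe_finset]
    congr 1
    ext v
    simp [hd]
  rw [hl]
  simp only [DegOneOrTwo, hd, OmegaBi, Set.mem_ofPred_eq]

end Degrees

/-! ### Graphs of maximum degree two are unions of paths and cycles. -/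

section Classification

variable {V : Type}

lemma nonempty_iso_sum_induce {m : ℕ} (G : SimpleGraph V) (K : SimpleGraph (Fin m))
    (f : Fin m → V) (hf : f.Injective) (hK : ∀ i j, G.Adj (f i) (f j) ↔ K.Adj i j)
    (hcl : ∀ i w, G.Adj (f i) w → w ∈ Set.range f) :
    Nonempty (G ≃g K ⊕g G.induce (Set.range f)ᶜ) := by
  classical
  refine ⟨Iso.symm ⟨((Equiv.ofInjective f hf).sumCongr (Equiv.refl _)).trans
    (Equiv.Set.sumCompl (Set.range f)), ?_⟩⟩
  rintro (i | ⟨v, hv⟩) (j | ⟨w, hw⟩)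
  · simpa using hK i j
  · simpa using fun h => hw (hcl i w h)
  · simpa using fun h => hv (hcl j v h.symm)
  · simp

/-- `f` enumerates on the first `m` numbers the successive vertices of a path of `G`. -/
def IsPathSeq (G : SimpleGraph V) (m : ℕ) (f : ℕ → V) : Prop :=
  (∀ i j, i < m → j < m → f i = f j → i = j) ∧ ∀ i, i + 1 < m → G.Adj (f i) (f (i + 1))

lemma IsPathSeq.le_card [Fintype V] {G : SimpleGraph V} {m : ℕ} {f : ℕ → V}
    (h : IsPathSeq G m f) : m ≤ Fintype.card V := by
  have := Fintype.card_le_of_injective (fun i : Fin m => f i)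
    fun i j hij => Fin.ext (h.1 i j i.2 j.2 hij)
  rwa [Fintype.card_fin] at this

lemma exists_maximal_isPathSeq [Fintype V] [Nonempty V] (G : SimpleGraph V) :
    ∃ m f, 1 ≤ m ∧ IsPathSeq G m f ∧ ∀ g, ¬ IsPathSeq G (m + 1) g := by
  classical
  have h1 : ∃ f, IsPathSeq G 1 f :=
    ⟨fun _ => Classical.arbitrary V, fun i j hi hj _ => by omega, fun i hi => by omega⟩
  have hle : 1 ≤ Fintype.card V := Fintype.card_pos
  obtain ⟨f, hf⟩ := Nat.findGreatest_spec (P := fun m => ∃ f, IsPathSeq G m f) hle h1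
  refine ⟨_, f, Nat.le_findGreatest hle h1, hf, fun g hg => ?_⟩
  have := Nat.le_findGreatest (P := fun m => ∃ f, IsPathSeq G m f) hg.le_card ⟨g, hg⟩
  omega

/-- The vertices of a longest path form a component, whose only possible edge beyond the path joins
its two ends. -/
lemma IsPathSeq.adj_of_maximal {G : SimpleGraph V}
    (hdeg : ∀ v a b c, G.Adj v a → G.Adj v b → G.Adj v c → a = b ∨ a = c ∨ b = c)
    {m : ℕ} {f : ℕ → V} (hf : IsPathSeq G m f) (hmax : ∀ g, ¬ IsPathSeq G (m + 1) g)
    {i : ℕ} (hi : i < m) {w : V} (hw : G.Adj (f i) w) : ∃ j, j < m ∧ w = f j ∧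
      (i + 1 = j ∨ j + 1 = i ∨ (i = 0 ∧ j + 1 = m) ∨ (j = 0 ∧ i + 1 = m)) := by
  obtain ⟨hinj, hadj⟩ := hf
  have hint : ∀ j w, 0 < j → j + 1 < m → G.Adj (f j) w → w = f (j - 1) ∨ w = f (j + 1) := by
    intro j w h0 h1 h
    have e1 := hadj (j - 1) (by omega)
    rw [Nat.sub_add_cancel h0] at e1
    rcases hdeg _ _ _ _ h e1.symm (hadj j h1) with h | h | h
    · exact .inl h
    · exact .inr h
    · have := hinj _ _ (by omega) h1 h
      omega
  by_cases hii : 0 < i ∧ i + 1 < m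
  · rcases hint i w hii.1 hii.2 hw with rfl | rfl
    · exact ⟨i - 1, by omega, rfl, by omega⟩
    · exact ⟨i + 1, by omega, rfl, by omega⟩
  -- A neighbour of an end lying off the path would prolong it, at the front or at the back.
  have hmem : ∃ j, j < m ∧ w = f j := by
    by_contra! hne
    rcases Nat.eq_zero_or_pos i with rfl | hpos
    · refine hmax (fun j => if j = 0 then w else f (j - 1)) ⟨?_, ?_⟩
      · intro a b ha hb hab
        simp only at hab
        split_ifs at hab with h1 h2 h2
        · omega
        · exact absurd hab (hne _ (by omega))
        · exact absurd hab.symm (hne _ (by omega))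
        · have := hinj _ _ (by omega) (by omega) hab
          omega
      · intro a ha
        simp only
        rcases Nat.eq_zero_or_pos a with rfl | ha0
        · simpa using hw.symm
        · rw [if_neg (by omega), if_neg (by omega)]
          have := hadj (a - 1) (by omega)
          rwa [Nat.sub_add_cancel ha0] at this
    · have him : i + 1 = m := by omega
      refine hmax (fun j => if j < m then f j else w) ⟨?_, ?_⟩
      · intro a b ha hb hab
        simp only at hab
        split_ifs at hab with h1 h2 h2
        · exact hinj _ _ h1 h2 hab
        · exact absurd hab.symm (hne _ h1)
        · exact absurd hab (hne _ h2)
        · omega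
      · intro a ha
        simp only
        rw [if_pos (by omega)]
        split_ifs with h
        · exact hadj a h
        · rw [show a = i by omega]; exact hw
  obtain ⟨j, hj, rfl⟩ := hmem
  refine ⟨j, hj, rfl, ?_⟩
  have hne : i ≠ j := fun h => hw.ne (by rw [h])
  -- An inner vertex already has its two neighbours on the path; otherwise `i` and `j` are the two
  -- distinct ends.
  by_cases hjj : 0 < j ∧ j + 1 < m
  · rcases hint j _ hjj.1 hjj.2 hw.symm with h | h
    · have := hinj _ _ hi (by omega) h; omega
    · have := hinj _ _ hi (by omega) h; omega
  · omega

/-- Induction on the number of vertices: a longest path spans a component, which is split off, and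
the rest still has degrees at most two. -/
theorem exists_hasShape_of_degree_le_two [Fintype V] (G : SimpleGraph V)
    (hdeg : ∀ v a b c, G.Adj v a → G.Adj v b → G.Adj v c → a = b ∨ a = c ∨ b = c) :
    ∃ P C, HasShape G P C ∧ (∀ a ∈ P, 1 ≤ a) ∧ ∀ c ∈ C, 3 ≤ c := by
  classical
  induction hN : Fintype.card V using Nat.strong_induction_on generalizing V with
  | _ N ih =>
  rcases isEmpty_or_nonempty V with hV | hV
  · exact ⟨0, 0, .of_isEmpty G, by simp, by simp⟩
  obtain ⟨m, f, hm, hf, hmax⟩ := exists_maximal_isPathSeq G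
  have hadj {i : ℕ} (hi : i < m) {w : V} := hf.adj_of_maximal hdeg hmax (w := w) hi
  have hinj : Function.Injective (fun i : Fin m => f i) :=
    fun i j hij => Fin.ext (hf.1 i j i.2 j.2 hij)
  have hcl : ∀ (i : Fin m) w, G.Adj (f i) w → w ∈ Set.range (fun i : Fin m => f i) := by
    intro i w h
    obtain ⟨j, hj, rfl, _⟩ := hadj i.2 h
    exact ⟨⟨j, hj⟩, rfl⟩
  obtain ⟨P, C, hPC, hP, hC⟩ := ih (Fintype.card ↥(Set.range (fun i : Fin m => f i))ᶜ) (by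
      rw [← hN]
      exact Fintype.card_subtype_lt (x := f 0) (fun h => h ⟨⟨0, hm⟩, rfl⟩))
    (G.induce (Set.range (fun i : Fin m => f i))ᶜ)
    (fun v a b c ha hb hc => by
      simpa only [Subtype.ext_iff] using hdeg v a b c ha hb hc) rfl
  by_cases hcyc : 3 ≤ m ∧ G.Adj (f 0) (f (m - 1))
  · obtain ⟨n, rfl⟩ := Nat.exists_eq_add_of_le' hcyc.1
    have hK : ∀ i j : Fin (n + 3), G.Adj (f i) (f j) ↔ (cycleGraph (n + 3)).Adj i j := by
      intro i j
      rw [cycleGraph_adj_iff_val]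
      constructor
      · intro h
        obtain ⟨j', hj', he, h⟩ := hadj i.2 h
        obtain rfl := hf.1 _ _ j.2 hj' he
        omega
      · have h2 := hcyc.2
        rw [show n + 3 - 1 = n + 2 by omega] at h2
        rintro (h | h | ⟨h, h'⟩ | ⟨h, h'⟩)
        · rw [← h]; exact hf.2 i (by omega)
        · rw [← h]; exact (hf.2 j (by omega)).symm
        · rw [h, h']; exact h2
        · rw [h, h']; exact h2.symm
    refine ⟨0 + P, {n + 3} + C, ((hasShape_cycleGraph (n + 3)).sum hPC).congr
      (nonempty_iso_sum_induce G _ _ hinj hK hcl), by simpa using hP, ?_⟩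
    simpa using hC
  · have hK : ∀ i j : Fin m, G.Adj (f i) (f j) ↔ (pathGraph m).Adj i j := by
      intro i j
      rw [pathGraph_adj]
      constructor
      · intro h
        obtain ⟨j', hj', he, h'⟩ := hadj i.2 h
        obtain rfl := hf.1 _ _ j.2 hj' he
        rcases h' with h' | h' | ⟨h1, h2⟩ | ⟨h1, h2⟩
        · omega
        · omega
        -- Adjacent ends without a cycle force $m=2$, where the ends are consecutive.
        · rw [h1, show (j : ℕ) = m - 1 by omega] at h
          have hne : m - 1 ≠ 0 := fun h0 => h.ne (by rw [h0])
          have : ¬ 3 ≤ m := fun h3 => hcyc ⟨h3, h⟩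
          omega
        · rw [h1, show (i : ℕ) = m - 1 by omega] at h
          have hne : m - 1 ≠ 0 := fun h0 => h.ne (by rw [h0])
          have : ¬ 3 ≤ m := fun h3 => hcyc ⟨h3, h.symm⟩
          omega
      · rintro (h | h)
        · rw [← h]; exact hf.2 i (by omega)
        · rw [← h]; exact (hf.2 j (by omega)).symm
    refine ⟨{m} + P, 0 + C, ((hasShape_pathGraph m).sum hPC).congr
      (nonempty_iso_sum_induce G _ _ hinj hK hcl), ?_, by simpa using hC⟩
    simpa [hm] using hP

end Classification

/-! ### From shapes back to graphs, and the extremal argument. -/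

lemma HasShape.matchingPoly_eq {n k : ℕ} {G : SimpleGraph (Fin n)} {P C : Multiset ℕ}
    (h : HasShape G P C) (hg : GoodShape n k P C) : matchingPoly G = shapePoly P C := by
  rw [matchingPoly_eq_genPoly]
  exact h.genPoly_eq fun c hc => by have := hg.cycle c hc; omega

lemma HasShape.mem_OmegaBi {n k : ℕ} {G : SimpleGraph (Fin n)} {P C : Multiset ℕ}
    (h : HasShape G P C) (hg : GoodShape n k P C) : G ∈ OmegaBi n k :=
  mem_OmegaBi_iff.2 <| (h.goodShape_iff (fun a ha => by have := hg.two_le a ha; omega)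
    fun c hc => by have := hg.cycle c hc; omega).2 hg

lemma exists_goodShape_of_mem_OmegaBi {n k : ℕ} {G : SimpleGraph (Fin n)}
    (hG : G ∈ OmegaBi n k) : ∃ P C, HasShape G P C ∧ GoodShape n k P C := by
  rw [mem_OmegaBi_iff] at hG
  obtain ⟨P, C, h, hP, hC⟩ := exists_hasShape_of_degree_le_two G (by
    intro v a b c ha hb hc
    by_contra! hne
    have hsub : ({a, b, c} : Set (Fin n)) ⊆ G.neighborSet v := by
      rintro x (rfl | rfl | rfl)
      exacts [ha, hb, hc]
    have h3 : ({a, b, c} : Set (Fin n)).ncard = 3 :=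
      Set.ncard_eq_three.2 ⟨a, b, c, hne.1, hne.2.1, hne.2.2, rfl⟩
    have := Set.ncard_le_ncard hsub
    rcases hG.2.2 v with h | h <;> omega)
  exact ⟨P, C, h, (h.goodShape_iff hP hC).1 hG⟩

lemma GoodShape.exists_hasShape {n k : ℕ} {P C : Multiset ℕ} (h : GoodShape n k P C) :
    ∃ G : SimpleGraph (Fin n), HasShape G P C := exists_hasShape_of_sum h.sum

lemma mem_GraphsF_iff {n k l : ℕ} {G : SimpleGraph (Fin n)} :
    G ∈ GraphsF n k l ↔ ∃ P C, IsShapeF k l P C ∧ HasShape G P C := by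
  have e₁ := HasShape.iff_isoTo (G := G)
    ((hasShape_copies_pathGraph l 3).sum (hasShape_copies_pathGraph (k - l) 2))
  have e₂ (m : ℕ) := HasShape.iff_isoTo (G := G)
    ((hasShape_copies_pathGraph (k - 1) 3).sum (hasShape_pathGraph m))
  have e₃ := HasShape.iff_isoTo (G := G)
    ((hasShape_copies_pathGraph k 3).sum (hasShape_cycleGraph (l - k)))
  rw [add_zero] at e₁
  rw [add_zero, zero_add] at e₃
  simp only [add_zero] at e₂
  simp only [GraphsF, Set.mem_ofPred_eq, ← e₁, ← e₂, ← e₃, IsShapeF, Nat.even_iff, Nat.odd_iff]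
  constructor
  · rintro (⟨h, i⟩ | ⟨h, i⟩ | ⟨h, h', i⟩ | ⟨h, i⟩ | ⟨h, h', i⟩)
    · exact ⟨_, _, .inl ⟨h, rfl, rfl⟩, i⟩
    · exact ⟨_, _, .inr (.inl ⟨h, rfl, rfl⟩), i⟩
    · exact ⟨_, _, .inr (.inr (.inl ⟨h, h', rfl, rfl⟩)), i⟩
    · exact ⟨_, _, .inr (.inr (.inr (.inl ⟨h, rfl, rfl⟩))), i⟩
    · exact ⟨_, _, .inr (.inr (.inr (.inr ⟨h, h', rfl, rfl⟩))), i⟩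
  · rintro ⟨P, C, ⟨h, rfl, rfl⟩ | ⟨h, rfl, rfl⟩ | ⟨h, h', rfl, rfl⟩ | ⟨h, rfl, rfl⟩ |
      ⟨h, h', rfl, rfl⟩, i⟩
    · exact .inl ⟨h, i⟩
    · exact .inr (.inl ⟨h, i⟩)
    · exact .inr (.inr (.inl ⟨h, h', i⟩))
    · exact .inr (.inr (.inr (.inl ⟨h, i⟩)))
    · exact .inr (.inr (.inr (.inr ⟨h, h', i⟩)))

lemma mem_GraphsH_iff {n k l : ℕ} {G : SimpleGraph (Fin n)} :
    G ∈ GraphsH n k l ↔ ∃ P C, IsShapeH k l P C ∧ HasShape G P C := by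
  have e₁ (m : ℕ) := HasShape.iff_isoTo (G := G)
    ((hasShape_copies_pathGraph (k - 1) 2).sum (hasShape_pathGraph m))
  have e₂ (q : ℕ) := HasShape.iff_isoTo (G := G)
    ((hasShape_copies_pathGraph k 2).sum (hasShape_copies_cycleGraph q 4))
  have e₃ (q m : ℕ) := HasShape.iff_isoTo (G := G)
    (((hasShape_copies_pathGraph (k - 1) 2).sum (hasShape_copies_cycleGraph q 4)).sum
      (hasShape_pathGraph m))
  have e₄ (q : ℕ) := HasShape.iff_isoTo (G := G)
    (((hasShape_copies_pathGraph k 2).sum (hasShape_copies_cycleGraph q 4)).sum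
      (hasShape_cycleGraph 6))
  simp only [add_zero, zero_add] at e₁ e₂ e₃ e₄
  simp only [GraphsH, Set.mem_ofPred_eq, ← e₁, ← e₂, ← e₃, ← e₄, IsShapeH]
  constructor
  · rintro (⟨h, i⟩ | ⟨h, i⟩ | ⟨h, h', i⟩ | ⟨h, h', i⟩ | ⟨h, h', i⟩ | ⟨h, h', i⟩ | ⟨h, h', i⟩)
    · exact ⟨_, _, .inl ⟨h, rfl, rfl⟩, i⟩
    · exact ⟨_, _, .inr (.inl ⟨h, rfl, rfl⟩), i⟩
    · exact ⟨_, _, .inr (.inr (.inl ⟨h, h', rfl, rfl⟩)), i⟩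
    · exact ⟨_, _, .inr (.inr (.inr (.inl ⟨h, h', rfl, rfl⟩))), i⟩
    · exact ⟨_, _, .inr (.inr (.inr (.inr (.inl ⟨h, h', rfl, rfl⟩)))), i⟩
    · exact ⟨_, _, .inr (.inr (.inr (.inr (.inr (.inl ⟨h, h', rfl, rfl⟩))))), i⟩
    · exact ⟨_, _, .inr (.inr (.inr (.inr (.inr (.inr ⟨h, h', rfl, rfl⟩))))), i⟩
  · rintro ⟨P, C, ⟨h, rfl, rfl⟩ | ⟨h, rfl, rfl⟩ | ⟨h, h', rfl, rfl⟩ | ⟨h, h', rfl, rfl⟩ |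
      ⟨h, h', rfl, rfl⟩ | ⟨h, h', rfl, rfl⟩ | ⟨h, h', rfl, rfl⟩, i⟩
    · exact .inl ⟨h, i⟩
    · exact .inr (.inl ⟨h, i⟩)
    · exact .inr (.inr (.inl ⟨h, h', i⟩))
    · exact .inr (.inr (.inr (.inl ⟨h, h', i⟩)))
    · exact .inr (.inr (.inr (.inr (.inl ⟨h, h', i⟩))))
    · exact .inr (.inr (.inr (.inr (.inr (.inl ⟨h, h', i⟩)))))
    · exact .inr (.inr (.inr (.inr (.inr (.inr ⟨h, h', i⟩)))))

/-- A strict order on a finite set is well-founded, so the exchanges need no termination measure. -/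
lemma wellFounded_coeffLT (n : ℕ) : WellFounded
    fun G H : SimpleGraph (Fin n) => CoeffLT (matchingPoly G) (matchingPoly H) :=
  have : IsTrans (SimpleGraph (Fin n)) fun G H => CoeffLT (matchingPoly G) (matchingPoly H) :=
    ⟨fun _ _ _ => CoeffLT.trans⟩
  have : Std.Irrefl fun G H : SimpleGraph (Fin n) => CoeffLT (matchingPoly G) (matchingPoly H) :=
    ⟨fun _ => CoeffLT.irrefl _⟩
  Finite.wellFounded_of_trans_of_irrefl _

lemma wellFounded_coeffLT_swap (n : ℕ) : WellFounded
    fun G H : SimpleGraph (Fin n) => CoeffLT (matchingPoly H) (matchingPoly G) :=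
  have : IsTrans (SimpleGraph (Fin n)) fun G H => CoeffLT (matchingPoly H) (matchingPoly G) :=
    ⟨fun _ _ _ h h' => CoeffLT.trans h' h⟩
  have : Std.Irrefl fun G H : SimpleGraph (Fin n) => CoeffLT (matchingPoly H) (matchingPoly G) :=
    ⟨fun _ => CoeffLT.irrefl _⟩
  Finite.wellFounded_of_trans_of_irrefl _

lemma matchingPoly_eq_of_mem_GraphsF {n k l : ℕ} (hk : 1 ≤ k) (hn : n = 2 * k + l)
    {F G : SimpleGraph (Fin n)} (hF : F ∈ GraphsF n k l) (hG : G ∈ GraphsF n k l) :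
    matchingPoly F = matchingPoly G := by
  obtain ⟨P, C, h, i⟩ := mem_GraphsF_iff.1 hF
  obtain ⟨P', C', h', i'⟩ := mem_GraphsF_iff.1 hG
  rw [i.matchingPoly_eq (h.goodShape hk hn), i'.matchingPoly_eq (h'.goodShape hk hn),
    h.shapePoly_eq hk h']

lemma matchingPoly_eq_of_mem_GraphsH {n k l : ℕ} (hk : 1 ≤ k) (hn : n = 2 * k + l)
    {F G : SimpleGraph (Fin n)} (hF : F ∈ GraphsH n k l) (hG : G ∈ GraphsH n k l) :
    matchingPoly F = matchingPoly G := by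
  obtain ⟨P, C, h, i⟩ := mem_GraphsH_iff.1 hF
  obtain ⟨P', C', h', i'⟩ := mem_GraphsH_iff.1 hG
  rw [i.matchingPoly_eq (h.goodShape hk hn), i'.matchingPoly_eq (h'.goodShape hk hn),
    h.shapePoly_eq h']

/-- An unlisted `G` lies strictly above some `G'` of the same class. Either `G'` is listed and has
the polynomial of `F`, or the induction hypothesis applies to it. -/
lemma coeffLT_of_notMem_GraphsF {n k l : ℕ} (hk : 1 ≤ k) (hn : n = 2 * k + l)
    {F : SimpleGraph (Fin n)} (hF : F ∈ GraphsF n k l) {G : SimpleGraph (Fin n)}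
    (hG : G ∈ OmegaBi n k) (hGF : G ∉ GraphsF n k l) :
    CoeffLT (matchingPoly F) (matchingPoly G) := by
  induction G using (wellFounded_coeffLT n).induction with
  | _ G ih =>
    obtain ⟨P, C, h, hg⟩ := exists_goodShape_of_mem_OmegaBi hG
    rcases hg.isShapeF_or_exists_lt hn with hs | ⟨P', C', hg', hlt⟩
    · exact absurd (mem_GraphsF_iff.2 ⟨P, C, hs, h⟩) hGF
    · obtain ⟨G', h'⟩ := hg'.exists_hasShape
      rw [← h.matchingPoly_eq hg, ← h'.matchingPoly_eq hg'] at hlt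
      by_cases hmem : G' ∈ GraphsF n k l
      · rwa [matchingPoly_eq_of_mem_GraphsF hk hn hF hmem]
      · exact (ih G' hlt (h'.mem_OmegaBi hg') hmem).trans hlt

lemma coeffLT_of_notMem_GraphsH {n k l : ℕ} (hk : 1 ≤ k) (hn : n = 2 * k + l) (hl : 2 ≤ l)
    {H : SimpleGraph (Fin n)} (hH : H ∈ GraphsH n k l) {G : SimpleGraph (Fin n)}
    (hG : G ∈ OmegaBi n k) (hGH : G ∉ GraphsH n k l) :
    CoeffLT (matchingPoly G) (matchingPoly H) := by
  induction G using (wellFounded_coeffLT_swap n).induction with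
  | _ G ih =>
    obtain ⟨P, C, h, hg⟩ := exists_goodShape_of_mem_OmegaBi hG
    rcases hg.isShapeH_or_exists_gt hn hl with hs | ⟨P', C', hg', hlt⟩
    · exact absurd (mem_GraphsH_iff.2 ⟨P, C, hs, h⟩) hGH
    · obtain ⟨G', h'⟩ := hg'.exists_hasShape
      rw [← h.matchingPoly_eq hg, ← h'.matchingPoly_eq hg'] at hlt
      by_cases hmem : G' ∈ GraphsH n k l
      · rwa [matchingPoly_eq_of_mem_GraphsH hk hn hH hmem]
      · exact hlt.trans (ih G' hlt (h'.mem_OmegaBi hg') hmem)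

theorem mainTheorem2 (n k l : ℕ) (hk : 2 ≤ 2 * k) (hkn : 2 * k ≤ n) (hl : l = n - 2 * k)
    (hl2 : 2 ≤ l) :
    (GraphsF n k l).Nonempty ∧ (GraphsH n k l).Nonempty ∧
    GraphsF n k l ⊆ OmegaBi n k ∧ GraphsH n k l ⊆ OmegaBi n k ∧
    ∀ G ∈ OmegaBi n k, ∀ F ∈ GraphsF n k l, ∀ H ∈ GraphsH n k l,
      CoeffLE (matchingPoly F) (matchingPoly G) ∧
      CoeffLE (matchingPoly G) (matchingPoly H) ∧
      (G ∉ GraphsF n k l → CoeffLT (matchingPoly F) (matchingPoly G)) ∧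
      (G ∉ GraphsH n k l → CoeffLT (matchingPoly G) (matchingPoly H)) := by
  have hk1 : 1 ≤ k := by omega
  have hn : n = 2 * k + l := by omega
  refine ⟨?_, ?_, ?_, ?_, fun G hG F hF H hH => ⟨?_, ?_, ?_, ?_⟩⟩
  · obtain ⟨P, C, h⟩ := exists_isShapeF k l
    obtain ⟨G, hG⟩ := (h.goodShape hk1 hn).exists_hasShape
    exact ⟨G, mem_GraphsF_iff.2 ⟨P, C, h, hG⟩⟩
  · obtain ⟨P, C, h⟩ := exists_isShapeH k hl2
    obtain ⟨G, hG⟩ := (h.goodShape hk1 hn).exists_hasShape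
    exact ⟨G, mem_GraphsH_iff.2 ⟨P, C, h, hG⟩⟩
  · intro G hG
    obtain ⟨P, C, h, i⟩ := mem_GraphsF_iff.1 hG
    exact i.mem_OmegaBi (h.goodShape hk1 hn)
  · intro G hG
    obtain ⟨P, C, h, i⟩ := mem_GraphsH_iff.1 hG
    exact i.mem_OmegaBi (h.goodShape hk1 hn)
  · by_cases hmem : G ∈ GraphsF n k l
    · rw [matchingPoly_eq_of_mem_GraphsF hk1 hn hF hmem]
      exact CoeffLE.refl _
    · exact (coeffLT_of_notMem_GraphsF hk1 hn hF hG hmem).1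
  · by_cases hmem : G ∈ GraphsH n k l
    · rw [matchingPoly_eq_of_mem_GraphsH hk1 hn hmem hH]
      exact CoeffLE.refl _
    · exact (coeffLT_of_notMem_GraphsH hk1 hn hl2 hH hG hmem).1
  · exact coeffLT_of_notMem_GraphsF hk1 hn hF hG
  · exact coeffLT_of_notMem_GraphsH hk1 hn hl2 hH hG
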